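/- For $k\ge 1$ let $S_k$ be the set of permutations of $\{1,\dots,k\}$, and let $S_*=\bigcup_{k\ge1}S_k$ be the set of patterns; write $|\sigma|=k$ if $\sigma\in S_k$. For $\pi\in S_n$ and $\sigma\in S_k$ let $X_\sigma(\pi)$ be the number of index sequences $1\le i_1<\dots<i_k\le n$ such that $\pi(i_1),\dots,\pi(i_k)$ has the same order relations as $\sigma(1),\dots,\sigma(k)$. For $1\le i\le k$ and $x,y\in[0,1]$ define $$g_{k,i}(x)=\binom{k-1}{i-1}x^{i-1}(1-x)^{k-i},\qquad G_\sigma(x,y)=\frac1{(k-1)!^2}\Bigl(\sum_{i=1}^k g_{k,i}(x)\,g_{k,\sigma(i)}(y)-\frac1k\Bigr)\quad(\sigma\in S_k),$$ and $$\Sigma_{\sigma,\tau}=\int_0^1\!\int_0^1 G_\sigma(x,y)\,G_\tau(x,y)\,dx\,dy .$$ Every matrix $(\Sigma_{\sigma_a,\sigma_b})_{a,b}$ of a finite family of patterns is positive semidefinite; let $Z_\sigma$, $\sigma\in S_*$, be jointly normal (possibly degenerate) with $\mathbb E Z_\sigma=0$ and $\operatorname{Cov}(Z_\sigma,Z_\tau)=\Sigma_{\sigma,\tau}$.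 Let $\pi$ be uniformly random in $S_n$ and write $X_\sigma=X_\sigma(\pi)$. Then $\mathbb E X_\sigma=\frac1{|\sigma|!}\binom n{|\sigma|}$ and, for every $\sigma\in S_*$, as $n\to\infty$, $$\widetilde X_\sigma:=\frac{X_\sigma-\frac1{|\sigma|!}\binom n{|\sigma|}}{n^{|\sigma|-1/2}}\ \xrightarrow{d}\ Z_\sigma .$$ Moreover, the convergence holds jointly for any finite family $\sigma_1,\dots,\sigma_r$ of patterns. Furthermore, all joint moments converge: for all integers $m_1,\dots,m_r\ge0$, $$\mathbb E\prod_{a=1}^r\widetilde X_{\sigma_a}^{\,m_a}\to\mathbb E\prod_{a=1}^r Z_{\sigma_a}^{\,m_a}$$ (the right-hand side being finite); in particular, for all patterns $\sigma,\tau$, $$\frac{\operatorname{Cov}(X_\sigma,X_\tau)}{n^{|\sigma|+|\tau|-1}}\to\Sigma_{\sigma,\tau}.$$ -/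

import Mathlib

open MeasureTheory ProbabilityTheory Filter Topology
open scoped Nat

/-- A permutation pattern: a permutation of `{0, …, len - 1}` for some length `len ≥ 1`. -/
structure Pattern where
  len : ℕ
  one_le_len : 1 ≤ len
  perm : Equiv.Perm (Fin len)

/-- `τ` is the reduction of the sequence `a`: it has the same order relations as `a`. -/
def IsReduction {α : Type*} [LT α] {k : ℕ} (a : Fin k → α) (τ : Equiv.Perm (Fin k)) : Prop :=
  ∀ i j : Fin k, τ i < τ j ↔ a i < a j

/-- The number of occurrences of `σ` in `π`: the number of index sequences
`s 0 < s 1 < ⋯` such that the reduction of `π (s 0), π (s 1), …` is `σ`. -/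
noncomputable def patternCount (σ : Pattern) {n : ℕ} (π : Equiv.Perm (Fin n)) : ℕ :=
  Nat.card {s : Fin σ.len ↪o Fin n // IsReduction (fun i => π (s i)) σ.perm}

/-- Every set of permutations of `{0, …, n - 1}` is an event. -/
instance permMeasurableSpace (n : ℕ) : MeasurableSpace (Equiv.Perm (Fin n)) := ⊤

instance permDiscreteMeasurableSpace (n : ℕ) :
    DiscreteMeasurableSpace (Equiv.Perm (Fin n)) := ⟨fun _ => trivial⟩

/-- The law of a uniformly random permutation of `{0, …, n - 1}`. -/
noncomputable abbrev uniformPerm (n : ℕ) : Measure (Equiv.Perm (Fin n)) :=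
  uniformOn Set.univ

/-- The random variable `X_σ` on the permutations of `{0, …, n - 1}`, as a real number. -/
noncomputable def countVar (σ : Pattern) (n : ℕ) (π : Equiv.Perm (Fin n)) : ℝ :=
  patternCount σ π

/-- The normalized count `(X_σ - C(n, |σ|) / |σ|!) / n ^ (|σ| - 1/2)`. -/
noncomputable def normalizedCount (σ : Pattern) (n : ℕ) (π : Equiv.Perm (Fin n)) : ℝ :=
  (countVar σ n π - (n.choose σ.len : ℝ) / (σ.len ! : ℝ)) / (n : ℝ) ^ ((σ.len : ℝ) - 1 / 2)

/-- The polynomial `g_{k,i}(x) = C(k-1, i-1) x^(i-1) (1-x)^(k-i)`, for `1 ≤ i ≤ k`. -/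
noncomputable def bernsteinPoly (k i : ℕ) (x : ℝ) : ℝ :=
  ((k - 1).choose (i - 1) : ℝ) * x ^ (i - 1) * (1 - x) ^ (k - i)

/-- The kernel `G_σ(x, y) = (1 / (k-1)!²) (∑_{i=1}^k g_{k,i}(x) g_{k,σ(i)}(y) - 1/k)`, `k = |σ|`.
The shifts by one translate the indices `0, …, k - 1` of `Fin k` to `1, …, k`. -/
noncomputable def patternKernel (σ : Pattern) (x y : ℝ) : ℝ :=
  1 / ((σ.len - 1)! : ℝ) ^ 2 *
    (∑ i : Fin σ.len, bernsteinPoly σ.len ((i : ℕ) + 1) x *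
        bernsteinPoly σ.len ((σ.perm i : ℕ) + 1) y - 1 / (σ.len : ℝ))

/-- The asymptotic covariance `Σ_{σ,τ}`, the inner product of `G_σ` and `G_τ` in `L²([0,1]²)`. -/
noncomputable def limitCov (σ τ : Pattern) : ℝ :=
  ∫ x in (0 : ℝ)..1, ∫ y in (0 : ℝ)..1, patternKernel σ x y * patternKernel τ x y

/-- The random variables `Z i` are jointly normal (degenerate laws included) with mean zero and
covariances `Cov(Z i, Z j) = Σ_{σ i, σ j}`. -/
structure IsLimitFamily {ι : Type*} [Fintype ι] (σ : ι → Pattern) {Ω : Type*} [MeasurableSpace Ω]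
    (Z : ι → Ω → ℝ) (P : Measure Ω) : Prop where
  jointlyGaussian : HasGaussianLaw (fun ω i => Z i ω) P
  mean_eq_zero : ∀ i, ∫ ω, Z i ω ∂P = 0
  cov_eq : ∀ i j, covariance (Z i) (Z j) P = limitCov (σ i) (σ j)

/-!
A uniformly random permutation is the one induced by `n` independent uniform points of the unit
square: list the points by increasing first coordinate and record the ranks of their second
coordinates (`measurePreserving_inducedPerm`). The count `X_σ` becomes a V-statistic, the sum over
all `k`-tuples of points of the indicator that the tuple is an occurrence of `σ`
(`countVar_inducedPerm`).

Hoeffding's decomposition writes a V-statistic as its mean, plus `n ^ (k - 1)` times a sum of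
independent centered variables, plus a degenerate remainder (`vStat_eq_add`). Two terms of the
remainder are orthogonal unless their tuples share two points or both have a repetition, so that its
second moment is `O(n ^ (2k - 2))` (`integral_vStat_degeneratePart_sq_le`), negligible against
`n ^ (2k - 1)`. The summand of the linear part is the kernel `G_σ`
(`linearPart_patternInd_ae_eq`): given that one of `k` uniform variables equals `u`, the probability
that they are increasing and that this one is number `i` is `g_{k,i}(u) / (k - 1)!`, a volume
computed by integrating out one coordinate after the other (`integral_strictMonoInd_update`). With
the central limit theorem, this gives the limit of the characteristic function of every linear
combination of normalized counts (`tendsto_integral_cexp_normalizedCount`), hence joint convergence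
in distribution by the theorems of Cramér–Wold and Lévy.

For the moments, moving one point changes `X_σ` by `O(n ^ (k - 1))`; by McDiarmid's inequality the
normalized counts are sub-Gaussian uniformly in `n`
(`exists_integral_abs_normalizedCount_pow_le`). Hence products of their powers are uniformly
integrable, and their means converge too (`tendsto_integral_of_tendstoInDistribution`). The
covariances are the case of two factors, applied to a multivariate normal vector with covariance
matrix `Σ`, which exists because `Σ` is a Gram matrix (`posSemidef_limitCov`).
-/

/-! ### Resampling coordinates of a product measure -/

theorem integral_comp_measurePreserving {α β E : Type*} [MeasurableSpace α] [MeasurableSpace β]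
    [NormedAddCommGroup E] [NormedSpace ℝ E] {μ : Measure α} {μ' : Measure β} {f : α → β}
    (hf : MeasurePreserving f μ μ') {g : β → E} (hg : AEStronglyMeasurable g μ') :
    ∫ a, g (f a) ∂μ = ∫ b, g b ∂μ' := by
  have hg' : AEStronglyMeasurable g (μ.map f) := hf.map_eq.symm ▸ hg
  rw [← integral_map hf.measurable.aemeasurable hg', hf.map_eq]

section Resampling

variable {I : Type*} [MeasurableSpace I] (ν : Measure I) [IsProbabilityMeasure ν]
  {ι κ : Type*} [Fintype ι] [Fintype κ]

theorem measurePreserving_comp_injective {s : κ → ι} (hs : Function.Injective s) :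
    MeasurePreserving (fun (p : ι → I) a => p (s a))
      (Measure.pi fun _ => ν) (Measure.pi fun _ => ν) := by
  classical
  have hm : Measurable (fun (p : ι → I) a => p (s a)) := by fun_prop
  refine ⟨hm, ?_⟩
  refine (Measure.pi_eq fun B hB => ?_).symm
  rw [Measure.map_apply hm (MeasurableSet.univ_pi hB)]
  have hpre : (fun (p : ι → I) a => p (s a)) ⁻¹' Set.univ.pi B =
      Set.univ.pi (fun j => {x | ∀ a, s a = j → x ∈ B a}) := by
    ext p
    simp only [Set.mem_preimage, Set.mem_univ_pi, Set.mem_ofPred_eq]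
    exact ⟨fun h j a ha => ha ▸ h a, fun h a => h (s a) a rfl⟩
  rw [hpre, Measure.pi_pi]
  have hout : ∀ j ∉ Finset.univ.image s, ν {x | ∀ a, s a = j → x ∈ B a} = 1 := by
    intro j hj
    have : {x | ∀ a, s a = j → x ∈ B a} = Set.univ := by
      ext x
      simp only [Set.mem_ofPred_eq, Set.mem_univ, iff_true]
      intro a ha
      exact absurd (Finset.mem_image.2 ⟨a, Finset.mem_univ a, ha⟩) hj
    rw [this, measure_univ]
  rw [← Finset.prod_subset (Finset.subset_univ (Finset.univ.image s)) (fun j _ hj => hout j hj),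
    Finset.prod_image (fun a _ b _ h => hs h)]
  refine Finset.prod_congr rfl fun a _ => ?_
  congr 1
  ext x
  simp only [Set.mem_ofPred_eq]
  exact ⟨fun h => h a rfl, fun h b hb => hs hb ▸ h⟩

/-- Replacing the coordinates outside `T` by those of an independent copy does not change the law
of a family of independent variables. -/
theorem measurePreserving_piecewise [DecidableEq ι] (T : Finset ι) :
    MeasurePreserving (fun z : (ι → I) × (ι → I) => T.piecewise z.1 z.2)
      ((Measure.pi fun _ => ν).prod (Measure.pi fun _ => ν)) (Measure.pi fun _ => ν) := by
  have hm : Measurable (fun z : (ι → I) × (ι → I) => T.piecewise z.1 z.2) := by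
    refine measurable_pi_lambda _ fun j => ?_
    by_cases hj : j ∈ T
    · simp only [Finset.piecewise_eq_of_mem _ _ _ hj]; fun_prop
    · simp only [Finset.piecewise_eq_of_notMem _ _ _ hj]; fun_prop
  refine ⟨hm, ?_⟩
  refine (Measure.pi_eq fun B hB => ?_).symm
  rw [Measure.map_apply hm (MeasurableSet.univ_pi hB)]
  have hpre : (fun z : (ι → I) × (ι → I) => T.piecewise z.1 z.2) ⁻¹' Set.univ.pi B =
      (Set.univ.pi (fun j => if j ∈ T then B j else Set.univ)) ×ˢ
        (Set.univ.pi (fun j => if j ∈ T then Set.univ else B j)) := by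
    ext z
    simp only [Set.mem_preimage, Set.mem_univ_pi, Set.mem_prod, ← forall_and]
    refine forall_congr' fun j => ?_
    by_cases hj : j ∈ T <;> simp [hj]
  rw [hpre, Measure.prod_prod, Measure.pi_pi, Measure.pi_pi, ← Finset.prod_mul_distrib]
  refine Finset.prod_congr rfl fun j _ => ?_
  by_cases hj : j ∈ T <;> simp [hj]

/-- Conditioning on the coordinates in `T`: a factor depending only on these coordinates can be
pulled out of the integral over an independent copy of the others. -/
theorem integral_mul_eq_integral_piecewise [DecidableEq ι] (T : Finset ι) {F K : (ι → I) → ℝ}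
    (hF : Measurable F) (hK : Measurable K) {B C : ℝ} (hFB : ∀ p, |F p| ≤ B) (hKC : ∀ p, |K p| ≤ C)
    (hKT : ∀ p q, (∀ j ∈ T, p j = q j) → K p = K q) :
    ∫ p : ι → I, F p * K p ∂(Measure.pi fun _ : ι => ν) =
      ∫ p : ι → I, (∫ p' : ι → I, F (T.piecewise p p') ∂(Measure.pi fun _ : ι => ν)) * K p
        ∂(Measure.pi fun _ : ι => ν) := by
  have hmp := measurePreserving_piecewise ν T
  have hmeas : Measurable fun p => F p * K p := hF.mul hK
  have h1 : ∫ p : ι → I, F p * K p ∂(Measure.pi fun _ : ι => ν) =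
      ∫ z, F (T.piecewise z.1 z.2) * K z.1
        ∂((Measure.pi fun _ : ι => ν).prod (Measure.pi fun _ => ν)) := by
    rw [← integral_comp_measurePreserving hmp hmeas.aestronglyMeasurable]
    refine integral_congr_ae (Eventually.of_forall fun (z : (ι → I) × (ι → I)) => ?_)
    simp only
    rw [hKT (T.piecewise z.1 z.2) z.1 fun j hj => Finset.piecewise_eq_of_mem _ _ _ hj]
  have hint : Integrable (fun z : (ι → I) × (ι → I) => F (T.piecewise z.1 z.2) * K z.1)
      ((Measure.pi fun _ : ι => ν).prod (Measure.pi fun _ => ν)) := by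
    refine Integrable.of_bound
      ((hF.comp hmp.measurable).mul (hK.comp measurable_fst)).aestronglyMeasurable (B * C)
      (Eventually.of_forall fun z => ?_)
    rw [Real.norm_eq_abs, abs_mul]
    exact mul_le_mul (hFB _) (hKC _) (abs_nonneg _) ((abs_nonneg _).trans (hFB z.1))
  rw [h1, integral_prod _ hint]
  refine integral_congr_ae (Eventually.of_forall fun p => ?_)
  simp only
  rw [integral_mul_const]

end Resampling

/-! ### Counting index maps -/

section Counting

variable {k n : ℕ}

theorem card_filter_forall_mem_eq (A : Finset (Fin k)) (t : Fin k → Fin n) :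
    (Finset.univ.filter fun s : Fin k → Fin n => ∀ a ∈ A, s a = t a).card = n ^ (k - A.card) := by
  have : (Finset.univ.filter fun s : Fin k → Fin n => ∀ a ∈ A, s a = t a) =
      Fintype.piFinset fun a => if a ∈ A then {t a} else Finset.univ := by
    ext s
    simp only [Finset.mem_filter, Finset.mem_univ, true_and, Fintype.mem_piFinset]
    refine forall_congr' fun a => ?_
    by_cases ha : a ∈ A <;> simp [ha]
  rw [this, Fintype.card_piFinset]
  have h2 : ∀ a, (if a ∈ A then ({t a} : Finset (Fin n)) else Finset.univ).card =
      if a ∈ A then 1 else n := by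
    intro a; split_ifs <;> simp
  simp only [h2]
  rw [Finset.prod_ite]
  simp only [Finset.prod_const_one, Finset.prod_const, one_mul]
  congr 1
  rw [← Finset.compl_filter, Finset.card_compl]
  simp

theorem card_filter_apply_eq (a : Fin k) (j : Fin n) :
    (Finset.univ.filter fun s : Fin k → Fin n => s a = j).card = n ^ (k - 1) := by
  simpa using card_filter_forall_mem_eq {a} (fun _ => j)

theorem card_filter_apply_eq_apply_eq {a a' : Fin k} (ha : a ≠ a') (j j' : Fin n) :
    (Finset.univ.filter fun s : Fin k → Fin n => s a = j ∧ s a' = j').card = n ^ (k - 2) := by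
  have := card_filter_forall_mem_eq {a, a'} (fun b => if b = a then j else j')
  rw [Finset.card_pair ha] at this
  rw [← this]
  congr 1
  ext s
  simp [ha.symm]

theorem sum_comp_apply (a : Fin k) (f : Fin n → ℝ) :
    ∑ s : Fin k → Fin n, f (s a) = (n : ℝ) ^ (k - 1) * ∑ j, f j := by
  rw [← Finset.sum_fiberwise (s := Finset.univ) (g := fun s : Fin k → Fin n => s a), Finset.mul_sum]
  refine Finset.sum_congr rfl fun j _ => ?_
  rw [Finset.sum_congr rfl (g := fun _ => f j) (fun s hs => by rw [(Finset.mem_filter.1 hs).2]),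
    Finset.sum_const, card_filter_apply_eq, nsmul_eq_mul]
  push_cast; rfl

theorem card_filter_not_injective_le :
    (Finset.univ.filter fun s : Fin k → Fin n => ∃ a a', a ≠ a' ∧ s a = s a').card ≤
      k ^ 2 * n ^ (k - 1) := by
  classical
  have hsub : (Finset.univ.filter fun s : Fin k → Fin n => ∃ a a', a ≠ a' ∧ s a = s a') ⊆
      (Finset.univ : Finset (Fin k × Fin k)).biUnion fun c =>
        Finset.univ.filter fun s : Fin k → Fin n => c.1 ≠ c.2 ∧ s c.1 = s c.2 := by
    intro s hs
    obtain ⟨a, a', h⟩ := (Finset.mem_filter.1 hs).2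
    simp only [Finset.mem_biUnion, Finset.mem_univ, true_and, Finset.mem_filter]
    exact ⟨(a, a'), h⟩
  refine (Finset.card_le_card hsub).trans (Finset.card_biUnion_le.trans ?_)
  refine (Finset.sum_le_card_nsmul _ _ (n ^ (k - 1)) fun c _ => ?_).trans ?_
  · by_cases hc : c.1 = c.2
    · simp [hc]
    have hk : 2 ≤ k := by
      have h1 := c.1.2; have h2 := c.2.2
      have h3 : (c.1 : ℕ) ≠ c.2 := fun h => hc (Fin.ext h)
      omega
    have hsub2 : (Finset.univ.filter fun s : Fin k → Fin n => c.1 ≠ c.2 ∧ s c.1 = s c.2) ⊆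
        (Finset.univ : Finset (Fin n)).biUnion fun j =>
          Finset.univ.filter fun s : Fin k → Fin n => s c.1 = j ∧ s c.2 = j := by
      intro s hs
      have h := (Finset.mem_filter.1 hs).2
      simp only [Finset.mem_biUnion, Finset.mem_univ, true_and, Finset.mem_filter]
      exact ⟨s c.2, h.2, rfl⟩
    refine (Finset.card_le_card hsub2).trans (Finset.card_biUnion_le.trans ?_)
    simp only [card_filter_apply_eq_apply_eq hc, Finset.sum_const, Finset.card_univ,
      Fintype.card_fin, smul_eq_mul]
    rw [← pow_succ', show k - 2 + 1 = k - 1 by omega]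
  · simp [pow_two]

theorem card_filter_two_shared_le :
    (Finset.univ.filter fun c : (Fin k → Fin n) × (Fin k → Fin n) =>
      ∃ a a' b b', a ≠ a' ∧ c.1 a = c.2 b ∧ c.1 a' = c.2 b').card ≤
      k ^ 4 * n ^ (2 * (k - 1)) := by
  classical
  have hsub : (Finset.univ.filter fun c : (Fin k → Fin n) × (Fin k → Fin n) =>
      ∃ a a' b b', a ≠ a' ∧ c.1 a = c.2 b ∧ c.1 a' = c.2 b') ⊆
      (Finset.univ : Finset ((Fin k × Fin k) × (Fin k × Fin k))).biUnion fun e =>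
        Finset.univ.filter fun c : (Fin k → Fin n) × (Fin k → Fin n) =>
          e.1.1 ≠ e.1.2 ∧ c.1 e.1.1 = c.2 e.2.1 ∧ c.1 e.1.2 = c.2 e.2.2 := by
    intro s hs
    obtain ⟨a, a', b, b', h⟩ := (Finset.mem_filter.1 hs).2
    simp only [Finset.mem_biUnion, Finset.mem_univ, true_and, Finset.mem_filter]
    exact ⟨((a, a'), (b, b')), h⟩
  refine (Finset.card_le_card hsub).trans (Finset.card_biUnion_le.trans ?_)
  refine (Finset.sum_le_card_nsmul _ _ (n ^ (2 * (k - 1))) fun e _ => ?_).trans ?_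
  · by_cases hc : e.1.1 = e.1.2
    · simp [hc]
    have hk : 2 ≤ k := by
      have h1 := e.1.1.2; have h2 := e.1.2.2
      have h3 : (e.1.1 : ℕ) ≠ e.1.2 := fun h => hc (Fin.ext h)
      omega
    have hsub2 : (Finset.univ.filter fun c : (Fin k → Fin n) × (Fin k → Fin n) =>
          e.1.1 ≠ e.1.2 ∧ c.1 e.1.1 = c.2 e.2.1 ∧ c.1 e.1.2 = c.2 e.2.2) ⊆
        (Finset.univ : Finset (Fin k → Fin n)).biUnion fun s' =>
          (Finset.univ.filter fun s : Fin k → Fin n =>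
            s e.1.1 = s' e.2.1 ∧ s e.1.2 = s' e.2.2).image fun s => (s, s') := by
      intro c hc
      have h := (Finset.mem_filter.1 hc).2
      simp only [Finset.mem_biUnion, Finset.mem_univ, true_and, Finset.mem_filter,
        Finset.mem_image]
      exact ⟨c.2, c.1, h.2, rfl⟩
    refine (Finset.card_le_card hsub2).trans (Finset.card_biUnion_le.trans ?_)
    refine (Finset.sum_le_card_nsmul _ _ (n ^ (k - 2)) fun s' _ => ?_).trans ?_
    · exact Finset.card_image_le.trans (card_filter_apply_eq_apply_eq hc _ _).le
    · simp only [Finset.card_univ, Fintype.card_fun, Fintype.card_fin, smul_eq_mul]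
      rw [← pow_add, show k + (k - 2) = 2 * (k - 1) by omega]
  · simp only [Finset.card_univ, Fintype.card_prod, Fintype.card_fin, smul_eq_mul]
    apply le_of_eq; ring

end Counting

/-! ### The linear projection of a V-statistic -/

section VStatistic

variable {I : Type*} {k n : ℕ}

/-- The (unnormalized) V-statistic of the points `p` with a kernel `h` that need not be symmetric:
the sum of `h` over all `k`-tuples of points, repetitions included. -/
noncomputable def vStat (h : (Fin k → I) → ℝ) (p : Fin n → I) : ℝ :=
  ∑ s : Fin k → Fin n, h fun a => p (s a)

theorem abs_vStat_le {h : (Fin k → I) → ℝ} (hb : ∀ q, |h q| ≤ 1) (p : Fin n → I) :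
    |vStat h p| ≤ (n : ℝ) ^ k := by
  refine (Finset.abs_sum_le_sum_abs _ _).trans ?_
  refine (Finset.sum_le_card_nsmul _ _ 1 fun s _ => hb _).trans ?_
  simp

theorem abs_vStat_update_sub_le {h : (Fin k → I) → ℝ} (hb : ∀ q, |h q| ≤ 1)
    (p : Fin n → I) (j : Fin n) (x : I) :
    |vStat h (Function.update p j x) - vStat h p| ≤ 2 * k * (n : ℝ) ^ (k - 1) := by
  rw [vStat, vStat, ← Finset.sum_sub_distrib]
  refine (Finset.abs_sum_le_sum_abs _ _).trans ?_
  have h1 : ∀ s : Fin k → Fin n, |h (fun a => Function.update p j x (s a)) - h (fun a => p (s a))| ≤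
      ∑ a, if s a = j then (2 : ℝ) else 0 := by
    intro s
    by_cases hs : ∃ a, s a = j
    · obtain ⟨a, ha⟩ := hs
      refine ((abs_sub _ _).trans (add_le_add (hb _) (hb _))).trans ?_
      refine le_trans (by rw [if_pos ha]; norm_num) (Finset.single_le_sum
        (f := fun a => if s a = j then (2 : ℝ) else 0) (fun b _ => by positivity)
        (Finset.mem_univ a))
    · have : (fun a => Function.update p j x (s a)) = fun a => p (s a) :=
        funext fun a => Function.update_of_ne (fun e => hs ⟨a, e⟩) _ _
      rw [this, sub_self, abs_zero]
      positivity
  refine (Finset.sum_le_sum fun s _ => h1 s).trans (le_of_eq ?_)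
  rw [Finset.sum_comm]
  simp only [sum_comp_apply (n := n) _ (fun i => if i = j then (2 : ℝ) else 0)]
  simp
  ring

variable [MeasurableSpace I] (ν : Measure I)

/-- The mean of the kernel `h` at independent points with law `ν`. -/
noncomputable def kernelMean (h : (Fin k → I) → ℝ) : ℝ := ∫ q, h q ∂(Measure.pi fun _ => ν)

/-- The mean of the kernel `h` given that its argument `a` is `x`. -/
noncomputable def condMean (h : (Fin k → I) → ℝ) (a : Fin k) (x : I) : ℝ :=
  ∫ q, h (Function.update q a x) ∂(Measure.pi fun _ => ν)

/-- The first-order term of the Hoeffding decomposition, summed over the `k` arguments. -/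
noncomputable def linearPart (h : (Fin k → I) → ℝ) (x : I) : ℝ :=
  ∑ a, (condMean ν h a x - kernelMean ν h)

/-- The kernel `h` without its terms of order zero and one in the Hoeffding decomposition. -/
noncomputable def degeneratePart (h : (Fin k → I) → ℝ) (q : Fin k → I) : ℝ :=
  h q - kernelMean ν h - ∑ a, (condMean ν h a (q a) - kernelMean ν h)

theorem vStat_eq_add (h : (Fin k → I) → ℝ) (p : Fin n → I) :
    vStat h p = vStat (degeneratePart ν h) p + (n : ℝ) ^ k * kernelMean ν h +
      (n : ℝ) ^ (k - 1) * ∑ j, linearPart ν h (p j) := by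
  simp only [vStat, degeneratePart, Finset.sum_sub_distrib]
  have h1 : ∑ s : Fin k → Fin n, ∑ a, condMean ν h a (p (s a)) =
      (n : ℝ) ^ (k - 1) * ∑ a, ∑ j, condMean ν h a (p j) := by
    rw [Finset.sum_comm, Finset.mul_sum]
    exact Finset.sum_congr rfl fun a _ => sum_comp_apply a fun j => condMean ν h a (p j)
  have h2 : ∑ _s : Fin k → Fin n, ∑ _a : Fin k, kernelMean ν h =
      (n : ℝ) ^ (k - 1) * ∑ _a : Fin k, ∑ _j : Fin n, kernelMean ν h := by
    rw [Finset.sum_comm, Finset.mul_sum]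
    exact Finset.sum_congr rfl fun a _ => sum_comp_apply a fun _ => kernelMean ν h
  simp only [linearPart]
  rw [h1, h2, Finset.sum_comm (f := fun j a => condMean ν h a (p j) - kernelMean ν h)]
  simp only [Finset.sum_sub_distrib]
  have h3 : ∑ _s : Fin k → Fin n, kernelMean ν h = (n : ℝ) ^ k * kernelMean ν h := by
    simp
  rw [h3]
  ring

variable [IsProbabilityMeasure ν] {h : (Fin k → I) → ℝ}

theorem measurable_condMean (hm : Measurable h) (a : Fin k) : Measurable (condMean ν h a) := by
  have : Measurable fun z : I × (Fin k → I) => h (Function.update z.2 a z.1) := by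
    refine hm.comp (measurable_pi_lambda _ fun b => ?_)
    by_cases hb : b = a
    · subst hb; simp only [Function.update_self]; fun_prop
    · simp only [Function.update_of_ne hb]; fun_prop
  exact (this.stronglyMeasurable.integral_prod_right').measurable

theorem abs_integral_le_of_abs_le {α : Type*} [MeasurableSpace α] {μ : Measure α}
    [IsProbabilityMeasure μ] {f : α → ℝ} {C : ℝ} (hf : ∀ x, |f x| ≤ C) : |∫ x, f x ∂μ| ≤ C := by
  simpa using norm_integral_le_of_norm_le_const (μ := μ) (f := f) (C := C)
    (Eventually.of_forall hf)

theorem abs_condMean_le (hb : ∀ q, |h q| ≤ 1) (a : Fin k) (x : I) : |condMean ν h a x| ≤ 1 :=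
  abs_integral_le_of_abs_le fun _ => hb _

theorem abs_kernelMean_le (hb : ∀ q, |h q| ≤ 1) : |kernelMean ν h| ≤ 1 :=
  abs_integral_le_of_abs_le hb

theorem measurable_linearPart (hm : Measurable h) : Measurable (linearPart ν h) :=
  Finset.measurable_fun_sum _ fun a _ => (measurable_condMean ν hm a).sub_const _

theorem abs_sum_condMean_sub_le (hb : ∀ q, |h q| ≤ 1) (q : Fin k → I) :
    |∑ a, (condMean ν h a (q a) - kernelMean ν h)| ≤ 2 * k := by
  refine (Finset.abs_sum_le_sum_abs _ _).trans ?_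
  refine (Finset.sum_le_card_nsmul _ _ 2 fun a _ => ?_).trans ?_
  · refine (abs_sub _ _).trans ?_
    linarith [abs_condMean_le ν hb a (q a), abs_kernelMean_le ν hb]
  · simp [mul_comm]

theorem abs_linearPart_le (hb : ∀ q, |h q| ≤ 1) (x : I) : |linearPart ν h x| ≤ 2 * k :=
  abs_sum_condMean_sub_le ν hb fun _ => x

theorem measurable_degeneratePart (hm : Measurable h) : Measurable (degeneratePart ν h) := by
  refine (hm.sub_const _).sub (Finset.measurable_fun_sum _ fun a _ => ?_)
  exact ((measurable_condMean ν hm a).comp (measurable_pi_apply a)).sub_const _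

theorem abs_degeneratePart_le (hb : ∀ q, |h q| ≤ 1) (q : Fin k → I) :
    |degeneratePart ν h q| ≤ 2 + 2 * k := by
  refine (abs_sub _ _).trans ?_
  have := abs_sub (h q) (kernelMean ν h)
  linarith [hb q, abs_kernelMean_le ν hb, abs_sum_condMean_sub_le ν hb q]

theorem integrable_condMean (hm : Measurable h) (hb : ∀ q, |h q| ≤ 1) (a : Fin k) :
    Integrable (condMean ν h a) ν :=
  Integrable.of_bound (measurable_condMean ν hm a).aestronglyMeasurable 1
    (Eventually.of_forall (abs_condMean_le ν hb a))

/-- The law of total expectation, conditioning on the argument `a`. -/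
theorem integral_condMean (hm : Measurable h) (hb : ∀ q, |h q| ≤ 1) (a : Fin k) :
    ∫ x, condMean ν h a x ∂ν = kernelMean ν h := by
  have h1 := integral_mul_eq_integral_piecewise ν {a} hm (K := fun _ => 1) measurable_const hb
    (C := 1) (by simp) (by simp)
  simp only [mul_one, Finset.piecewise_singleton] at h1
  rw [kernelMean, h1]
  exact (integral_comp_measurePreserving (measurePreserving_eval (fun _ : Fin k => ν) a)
    (measurable_condMean ν hm a).aestronglyMeasurable).symm

theorem integral_condMean_eval {ι : Type*} [Fintype ι] (hm : Measurable h)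
    (hb : ∀ q, |h q| ≤ 1) (a : Fin k) (j : ι) :
    ∫ p : ι → I, condMean ν h a (p j) ∂(Measure.pi fun _ => ν) = kernelMean ν h := by
  rw [← integral_condMean ν hm hb a]
  exact integral_comp_measurePreserving (measurePreserving_eval (fun _ : ι => ν) j)
    (measurable_condMean ν hm a).aestronglyMeasurable

theorem integral_linearPart (hm : Measurable h) (hb : ∀ q, |h q| ≤ 1) :
    ∫ x, linearPart ν h x ∂ν = 0 := by
  have hi : ∀ a, Integrable (fun x => condMean ν h a x - kernelMean ν h) ν :=
    fun a => (integrable_condMean ν hm hb a).sub (integrable_const _)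
  simp only [linearPart]
  rw [integral_finsetSum _ fun a _ => hi a]
  refine Finset.sum_eq_zero fun a _ => ?_
  rw [integral_sub (integrable_condMean ν hm hb a) (integrable_const _),
    integral_condMean ν hm hb]
  simp

theorem integrable_of_measurable_of_abs_le {α : Type*} [MeasurableSpace α] {μ : Measure α}
    [IsFiniteMeasure μ] {f : α → ℝ} (hf : Measurable f) {C : ℝ} (hC : ∀ x, |f x| ≤ C) :
    Integrable f μ :=
  Integrable.of_bound hf.aestronglyMeasurable C (Eventually.of_forall hC)

theorem integral_degeneratePart (hm : Measurable h) (hb : ∀ q, |h q| ≤ 1) :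
    ∫ q, degeneratePart ν h q ∂(Measure.pi fun _ => ν) = 0 := by
  have hc : ∀ a, Integrable (fun q : Fin k → I => condMean ν h a (q a)) (Measure.pi fun _ => ν) :=
    fun a => integrable_of_measurable_of_abs_le (f := fun q : Fin k → I => condMean ν h a (q a))
      ((measurable_condMean ν hm a).comp (measurable_pi_apply a))
      (fun q => abs_condMean_le ν hb a (q a))
  have hi : ∀ a, Integrable (fun q : Fin k → I => condMean ν h a (q a) - kernelMean ν h)
      (Measure.pi fun _ => ν) := fun a => (hc a).sub (integrable_const _)
  have hh : Integrable h (Measure.pi fun _ => ν) := integrable_of_measurable_of_abs_le hm hb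
  have hh' : Integrable (fun q => h q - kernelMean ν h) (Measure.pi fun _ => ν) :=
    hh.sub (integrable_const _)
  simp only [degeneratePart]
  rw [integral_sub hh' (integrable_finsetSum _ fun a _ => hi a),
    integral_sub hh (integrable_const _), integral_finsetSum _ fun a _ => hi a]
  have : ∀ a, ∫ q : Fin k → I, condMean ν h a (q a) - kernelMean ν h
      ∂(Measure.pi fun _ => ν) = 0 := by
    intro a
    rw [integral_sub (hc a) (integrable_const _), integral_condMean_eval ν hm hb]
    simp
  rw [Finset.sum_eq_zero fun a _ => this a]
  simp [kernelMean]

/-- The degenerate part has mean zero even given one of its arguments. -/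
theorem integral_degeneratePart_update (hm : Measurable h) (hb : ∀ q, |h q| ≤ 1) (b : Fin k)
    (x : I) : ∫ q, degeneratePart ν h (Function.update q b x) ∂(Measure.pi fun _ => ν) = 0 := by
  have hup : Measurable fun q : Fin k → I => Function.update q b x := by fun_prop
  have hc : ∀ a, Integrable (fun q : Fin k → I => condMean ν h a (Function.update q b x a))
      (Measure.pi fun _ => ν) := fun a =>
    integrable_of_measurable_of_abs_le
      (f := fun q : Fin k → I => condMean ν h a (Function.update q b x a))
      ((measurable_condMean ν hm a).comp ((measurable_pi_apply a).comp hup))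
      (fun q => abs_condMean_le ν hb a _)
  have hi : ∀ a, Integrable (fun q : Fin k → I =>
      condMean ν h a (Function.update q b x a) - kernelMean ν h)
      (Measure.pi fun _ => ν) := fun a => (hc a).sub (integrable_const _)
  have hh : Integrable (fun q => h (Function.update q b x)) (Measure.pi fun _ => ν) :=
    integrable_of_measurable_of_abs_le (hm.comp hup) fun q => hb _
  have hh' : Integrable (fun q => h (Function.update q b x) - kernelMean ν h)
      (Measure.pi fun _ => ν) := hh.sub (integrable_const _)
  simp only [degeneratePart]
  rw [integral_sub hh' (integrable_finsetSum _ fun a _ => hi a),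
    integral_sub hh (integrable_const _), integral_finsetSum _ fun a _ => hi a]
  have : ∀ a, ∫ q : Fin k → I, condMean ν h a (Function.update q b x a) - kernelMean ν h
      ∂(Measure.pi fun _ => ν) = if a = b then condMean ν h b x - kernelMean ν h else 0 := by
    intro a
    rw [integral_sub (hc a) (integrable_const _)]
    by_cases hab : a = b
    · subst hab; simp
    · simp [integral_condMean_eval ν hm hb, hab]
  rw [Finset.sum_congr rfl fun a _ => this a]
  simp [condMean]

/-- The degenerate parts at two tuples of points are orthogonal, if the first tuple has no
repetition and shares at most one point with the second. -/
theorem integral_degeneratePart_mul_eq_zero (hm : Measurable h) (hb : ∀ q, |h q| ≤ 1)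
    {s t : Fin k → Fin n} (hs : Function.Injective s)
    (hst : ∀ a a' b b', s a = t b → s a' = t b' → a = a') :
    ∫ p : Fin n → I, degeneratePart ν h (fun a => p (s a)) *
      degeneratePart ν h (fun a => p (t a)) ∂(Measure.pi fun _ => ν) = 0 := by
  classical
  have hD := measurable_degeneratePart ν hm
  have hB := abs_degeneratePart_le ν hb
  rw [integral_mul_eq_integral_piecewise ν (Finset.univ.image t)
    (F := fun p => degeneratePart ν h (fun a => p (s a)))
    (K := fun p => degeneratePart ν h (fun a => p (t a))) (hD.comp (by fun_prop))
    (hD.comp (by fun_prop)) (fun _ => hB _) (fun _ => hB _)]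
  · have key : ∀ p : Fin n → I, ∫ p' : Fin n → I, degeneratePart ν h
        (fun a => (Finset.univ.image t).piecewise p p' (s a)) ∂(Measure.pi fun _ => ν) = 0 := by
      intro p
      by_cases hsh : ∃ a b, s a = t b
      · obtain ⟨a, b, hab⟩ := hsh
        have heq : ∀ p' : Fin n → I, (fun c => (Finset.univ.image t).piecewise p p' (s c)) =
            Function.update (fun c => p' (s c)) a (p (s a)) := by
          intro p'
          funext c
          by_cases hca : c = a
          · subst hca
            rw [Function.update_self, Finset.piecewise_eq_of_mem]
            exact Finset.mem_image.2 ⟨b, Finset.mem_univ _, hab.symm⟩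
          · rw [Function.update_of_ne hca, Finset.piecewise_eq_of_notMem]
            intro hmem
            obtain ⟨b', _, hb'⟩ := Finset.mem_image.1 hmem
            exact hca (hst c a b' b hb'.symm hab)
        simp only [heq]
        rw [← integral_degeneratePart_update ν hm hb a (p (s a))]
        exact integral_comp_measurePreserving (measurePreserving_comp_injective ν hs)
          (g := fun q => degeneratePart ν h (Function.update q a (p (s a))))
          (hD.comp (by fun_prop)).aestronglyMeasurable
      · have heq : ∀ p' : Fin n → I, (fun c => (Finset.univ.image t).piecewise p p' (s c)) =
            fun c => p' (s c) := by
          intro p'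
          funext c
          rw [Finset.piecewise_eq_of_notMem]
          intro hmem
          obtain ⟨b', _, hb'⟩ := Finset.mem_image.1 hmem
          exact hsh ⟨c, b', hb'.symm⟩
        simp only [heq]
        rw [← integral_degeneratePart ν hm hb]
        exact integral_comp_measurePreserving (measurePreserving_comp_injective ν hs)
          hD.aestronglyMeasurable
    simp [key]
  · intro p q hpq
    have : (fun a => p (t a)) = fun a => q (t a) := funext fun a =>
      hpq _ (Finset.mem_image.2 ⟨a, Finset.mem_univ _, rfl⟩)
    simp only [this]

theorem measurable_vStat (hm : Measurable h) : Measurable (vStat h : (Fin n → I) → ℝ) := by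
  unfold vStat
  exact Finset.measurable_fun_sum _ fun s _ => hm.comp (by fun_prop)

/-- The remainder of the linear approximation of a V-statistic has second moment of the order
`n ^ (2k - 2)`: only pairs of tuples that share two points, or both have a repetition,
contribute. -/
theorem integral_vStat_degeneratePart_sq_le (hm : Measurable h) (hb : ∀ q, |h q| ≤ 1) (n : ℕ) :
    ∫ p : Fin n → I, vStat (degeneratePart ν h) p ^ 2 ∂(Measure.pi fun _ => ν) ≤
      2 * (k : ℝ) ^ 4 * (2 + 2 * k) ^ 2 * (n : ℝ) ^ (2 * (k - 1)) := by
  classical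
  have hD := measurable_degeneratePart ν hm
  have hB := abs_degeneratePart_le ν hb
  set D := degeneratePart ν h
  let E : (Fin k → Fin n) × (Fin k → Fin n) → ℝ := fun c =>
    ∫ p : Fin n → I, D (fun a => p (c.1 a)) * D (fun a => p (c.2 a)) ∂(Measure.pi fun _ => ν)
  have hmeas : ∀ s : Fin k → Fin n, Measurable fun p : Fin n → I => D fun a => p (s a) :=
    fun s => hD.comp (by fun_prop)
  have hbd : ∀ (c : (Fin k → Fin n) × (Fin k → Fin n)) (p : Fin n → I),
      |D (fun a => p (c.1 a)) * D (fun a => p (c.2 a))| ≤ (2 + 2 * k) ^ 2 := by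
    intro c p
    rw [abs_mul, pow_two]
    exact mul_le_mul (hB _) (hB _) (abs_nonneg _) (by positivity)
  have hexp : ∫ p : Fin n → I, vStat D p ^ 2 ∂(Measure.pi fun _ => ν) = ∑ c, E c := by
    rw [← integral_finsetSum _ fun c _ => integrable_of_measurable_of_abs_le
      ((hmeas c.1).mul (hmeas c.2)) (hbd c)]
    refine integral_congr_ae (Eventually.of_forall fun p => ?_)
    simp only [vStat]
    rw [pow_two, Finset.sum_mul_sum, ← Finset.sum_product']
    rfl
  let S1 : Finset (Fin k → Fin n) := Finset.univ.filter fun s => ∃ a a', a ≠ a' ∧ s a = s a'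
  let S2 : Finset ((Fin k → Fin n) × (Fin k → Fin n)) := Finset.univ.filter fun c =>
      ∃ a a' b b', a ≠ a' ∧ c.1 a = c.2 b ∧ c.1 a' = c.2 b'
  have hzero : ∀ c ∉ S1 ×ˢ S1 ∪ S2, E c = 0 := by
    intro c hc
    rw [Finset.mem_union, not_or, Finset.mem_product, not_and_or] at hc
    obtain ⟨h1, h2⟩ := hc
    simp only [S1, S2, Finset.mem_filter, Finset.mem_univ, true_and] at h1 h2
    push Not at h1 h2
    have h3 : ∀ a a' b b', c.1 a = c.2 b → c.1 a' = c.2 b' → a = a' := by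
      intro a a' b b' e1 e2
      by_contra hne
      exact h2 a a' b b' hne e1 e2
    rcases h1 with h1 | h1
    · have hinj : Function.Injective c.1 := fun a a' e => by
        by_contra hne
        exact h1 a a' hne e
      exact integral_degeneratePart_mul_eq_zero ν hm hb hinj h3
    · have hinj : Function.Injective c.2 := fun a a' e => by
        by_contra hne
        exact h1 a a' hne e
      have h4 := integral_degeneratePart_mul_eq_zero ν hm hb (t := c.1) hinj
        (fun a a' b b' e1 e2 => hinj (by
          have : b = b' := h3 b b' a a' e1.symm e2.symm
          rw [e1, e2, this]))
      rw [← h4]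
      exact integral_congr_ae (Eventually.of_forall fun p => mul_comm _ _)
  rw [hexp, ← Finset.sum_subset (Finset.subset_univ (S1 ×ˢ S1 ∪ S2)) fun c _ hc => hzero c hc]
  have hEle : ∀ c ∈ S1 ×ˢ S1 ∪ S2, E c ≤ (2 + 2 * k) ^ 2 := by
    intro c _
    refine (le_abs_self _).trans ?_
    exact abs_integral_le_of_abs_le (hbd c)
  refine (Finset.sum_le_card_nsmul _ _ _ hEle).trans ?_
  have hcard : (S1 ×ˢ S1 ∪ S2).card ≤ 2 * k ^ 4 * n ^ (2 * (k - 1)) := by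
    refine (Finset.card_union_le _ _).trans ?_
    rw [Finset.card_product]
    have e1 : S1.card ≤ k ^ 2 * n ^ (k - 1) := by
      convert card_filter_not_injective_le (k := k) (n := n)
    have e2 : S2.card ≤ k ^ 4 * n ^ (2 * (k - 1)) := by
      convert card_filter_two_shared_le (k := k) (n := n)
    calc S1.card * S1.card + S2.card
        ≤ (k ^ 2 * n ^ (k - 1)) * (k ^ 2 * n ^ (k - 1)) + k ^ 4 * n ^ (2 * (k - 1)) :=
          add_le_add (Nat.mul_le_mul e1 e1) e2
      _ = 2 * k ^ 4 * n ^ (2 * (k - 1)) := by ring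
  rw [nsmul_eq_mul]
  have hcard' : ((S1 ×ˢ S1 ∪ S2).card : ℝ) ≤ 2 * (k : ℝ) ^ 4 * (n : ℝ) ^ (2 * (k - 1)) := by
    exact_mod_cast hcard
  calc ((S1 ×ˢ S1 ∪ S2).card : ℝ) * (2 + 2 * k) ^ 2
      ≤ (2 * (k : ℝ) ^ 4 * (n : ℝ) ^ (2 * (k - 1))) * (2 + 2 * k) ^ 2 := by gcongr
    _ = _ := by ring

end VStatistic

/-! ### Moment bounds from bounded differences -/

section BoundedDifferences

variable {I : Type*} [MeasurableSpace I] (ν : Measure I) [IsProbabilityMeasure ν] {n : ℕ}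

theorem measurePreserving_fin_cons (n : ℕ) :
    MeasurePreserving (fun z : I × (Fin n → I) => (Fin.cons z.1 z.2 : Fin (n + 1) → I))
      (ν.prod (Measure.pi fun _ => ν)) (Measure.pi fun _ => ν) := by
  have := (measurePreserving_piFinSuccAbove (fun _ : Fin (n + 1) => ν) 0).symm
  convert this using 1
  funext z
  exact (Fin.insertNth_zero (α := fun _ => I) z.1 z.2).symm

theorem integral_pi_succ {f : (Fin (n + 1) → I) → ℝ} (hf : Measurable f) {B : ℝ}
    (hB : ∀ p, |f p| ≤ B) :
    ∫ p, f p ∂(Measure.pi fun _ => ν) =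
      ∫ x, ∫ p : Fin n → I, f (Fin.cons x p) ∂(Measure.pi fun _ => ν) ∂ν := by
  have hmp := measurePreserving_fin_cons ν n
  rw [← integral_comp_measurePreserving hmp hf.aestronglyMeasurable]
  exact integral_prod _ (integrable_of_measurable_of_abs_le (hf.comp hmp.measurable) fun z => hB _)

/-- **McDiarmid's inequality** for moment generating functions: a function of independent
variables that changes by at most `c` when one variable changes is sub-Gaussian. -/
theorem integral_exp_le_of_bounded_differences {c : ℝ} (t : ℝ) :
    ∀ (n : ℕ) {f : (Fin n → I) → ℝ} {B : ℝ}, Measurable f → (∀ p, |f p| ≤ B) →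
      (∀ p j x, |f (Function.update p j x) - f p| ≤ c) →
      ∫ p, Real.exp (t * (f p - ∫ q, f q ∂(Measure.pi fun _ => ν))) ∂(Measure.pi fun _ => ν) ≤
        Real.exp (n * c ^ 2 * t ^ 2 / 2) := by
  intro n
  induction n with
  | zero =>
    intro f B _ _ _
    have : ∀ p : Fin 0 → I, f p - ∫ q, f q ∂(Measure.pi fun _ => ν) = 0 := by
      intro p
      have h : ∀ q : Fin 0 → I, f q = f p := fun q => by rw [Subsingleton.elim q p]
      simp [h]
    simp [this]
  | succ n ih =>
    intro f B hf hB hc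
    obtain ⟨x0⟩ : Nonempty I := nonempty_of_isProbabilityMeasure ν
    have hc0 : 0 ≤ c := (abs_nonneg _).trans (hc (fun _ => x0) 0 x0)
    have hmp := measurePreserving_fin_cons ν n
    have hfc : Measurable fun z : I × (Fin n → I) => f (Fin.cons z.1 z.2) :=
      hf.comp hmp.measurable
    have hfx : ∀ x, Measurable fun p : Fin n → I => f (Fin.cons x p) := fun x =>
      hfc.comp measurable_prodMk_left
    have hfi : ∀ x, Integrable (fun p : Fin n → I => f (Fin.cons x p)) (Measure.pi fun _ => ν) :=
      fun x => integrable_of_measurable_of_abs_le (hfx x) fun p => hB _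
    set m := ∫ q, f q ∂(Measure.pi fun _ => ν) with hm
    let F : I → ℝ := fun x => ∫ p : Fin n → I, f (Fin.cons x p) ∂(Measure.pi fun _ => ν)
    have hFm : Measurable F := (hfc.stronglyMeasurable.integral_prod_right').measurable
    have hFB : ∀ x, |F x| ≤ B := fun x => abs_integral_le_of_abs_le fun p => hB _
    have hmF : m = ∫ x, F x ∂ν := integral_pi_succ ν hf hB
    have hFi : Integrable F ν := integrable_of_measurable_of_abs_le hFm hFB
    have hFd : ∀ x y, |F x - F y| ≤ c := by
      intro x y
      simp only [F]
      rw [← integral_sub (hfi x) (hfi y)]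
      refine abs_integral_le_of_abs_le fun p => ?_
      have := hc (Fin.cons y p) 0 x
      rwa [Fin.update_cons_zero] at this
    have hFc : ∀ x, |F x - m| ≤ c := by
      intro x
      have h1 : F x - m = ∫ y, (F x - F y) ∂ν := by
        rw [integral_sub (integrable_const _) hFi, hmF]; simp
      rw [h1]
      exact abs_integral_le_of_abs_le fun y => hFd x y
    have hbound : ∀ p, |t * (f p - m)| ≤ |t| * (2 * B) := by
      intro p
      rw [abs_mul]
      refine mul_le_mul_of_nonneg_left ((abs_sub _ _).trans ?_) (abs_nonneg _)
      have : |m| ≤ B := abs_integral_le_of_abs_le hB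
      linarith [hB p]
    have hexpB : ∀ p, |Real.exp (t * (f p - m))| ≤ Real.exp (|t| * (2 * B)) := by
      intro p
      rw [abs_of_pos (Real.exp_pos _)]
      exact Real.exp_le_exp.2 ((le_abs_self _).trans (hbound p))
    rw [integral_pi_succ ν (f := fun p => Real.exp (t * (f p - m))) (by fun_prop) hexpB]
    have hinner : ∀ x, ∫ p : Fin n → I, Real.exp (t * (f (Fin.cons x p) - m))
        ∂(Measure.pi fun _ => ν) ≤ Real.exp (t * (F x - m)) * Real.exp (n * c ^ 2 * t ^ 2 / 2) := by
      intro x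
      have h1 : ∀ p : Fin n → I, Real.exp (t * (f (Fin.cons x p) - m)) =
          Real.exp (t * (F x - m)) * Real.exp (t * (f (Fin.cons x p) - F x)) := by
        intro p
        rw [← Real.exp_add]; congr 1; ring
      simp only [h1]
      rw [integral_const_mul]
      refine mul_le_mul_of_nonneg_left ?_ (Real.exp_pos _).le
      refine ih (hfx x) (fun p => hB _) fun p j y => ?_
      have := hc (Fin.cons x p) j.succ y
      rwa [← Fin.cons_update] at this
    have hFexp : Integrable (fun x => Real.exp (t * (F x - m))) ν := by
      refine integrable_of_measurable_of_abs_le (C := Real.exp (|t| * c)) (by fun_prop) fun x => ?_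
      rw [abs_of_pos (Real.exp_pos _)]
      refine Real.exp_le_exp.2 ((le_abs_self _).trans ?_)
      rw [abs_mul]
      exact mul_le_mul_of_nonneg_left (hFc x) (abs_nonneg _)
    refine (integral_mono_of_nonneg (Eventually.of_forall fun x => integral_nonneg fun p =>
      (Real.exp_pos _).le) (hFexp.mul_const _) (Eventually.of_forall hinner)).trans ?_
    rw [integral_mul_const]
    have hoeff : ∫ x, Real.exp (t * (F x - m)) ∂ν ≤ Real.exp (c ^ 2 * t ^ 2 / 2) := by
      have hs := hasSubgaussianMGF_of_mem_Icc_of_integral_eq_zero (μ := ν) (a := -c) (b := c)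
        (X := fun x => F x - m) (by fun_prop)
        (Eventually.of_forall fun x => abs_le.1 (hFc x))
        (by rw [integral_sub hFi (integrable_const _), hmF]; simp)
      have h2 := hs.mgf_le t
      rw [mgf] at h2
      refine h2.trans (le_of_eq ?_)
      congr 3
      push_cast
      rw [Real.norm_of_nonneg (by linarith)]
      ring
    calc (∫ x, Real.exp (t * (F x - m)) ∂ν) * Real.exp (n * c ^ 2 * t ^ 2 / 2)
        ≤ Real.exp (c ^ 2 * t ^ 2 / 2) * Real.exp (n * c ^ 2 * t ^ 2 / 2) :=
          mul_le_mul_of_nonneg_right hoeff (Real.exp_pos _).le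
      _ = Real.exp (((n + 1 : ℕ) : ℝ) * c ^ 2 * t ^ 2 / 2) := by
          rw [← Real.exp_add]; congr 1; push_cast; ring

/-- All centered moments of a function with bounded differences are of the order of the
corresponding powers of `c √n`. -/
theorem integral_abs_sub_pow_le_of_bounded_differences {c : ℝ} (hc0 : 0 < c) (hn : 0 < n)
    {f : (Fin n → I) → ℝ} {B : ℝ} (hf : Measurable f) (hB : ∀ p, |f p| ≤ B)
    (hc : ∀ p j x, |f (Function.update p j x) - f p| ≤ c) (T : ℕ) :
    ∫ p, |f p - ∫ q, f q ∂(Measure.pi fun _ => ν)| ^ T ∂(Measure.pi fun _ => ν) ≤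
      2 * T ! * Real.exp (1 / 2) * (c * √n) ^ T := by
  set m := ∫ q, f q ∂(Measure.pi fun _ => ν) with hm
  set b := c * √n with hb
  have hb0 : 0 < b := mul_pos hc0 (Real.sqrt_pos.2 (by exact_mod_cast hn))
  have hbd : ∀ p, |f p - m| ≤ 2 * B := by
    intro p
    have : |m| ≤ B := abs_integral_le_of_abs_le hB
    exact (abs_sub _ _).trans (by linarith [hB p])
  have hexp : ∀ t : ℝ, Integrable (fun p => Real.exp (t * (f p - m))) (Measure.pi fun _ => ν) := by
    intro t
    refine integrable_of_measurable_of_abs_le (C := Real.exp (|t| * (2 * B))) (by fun_prop)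
      fun p => ?_
    rw [abs_of_pos (Real.exp_pos _)]
    refine Real.exp_le_exp.2 ((le_abs_self _).trans ?_)
    rw [abs_mul]
    exact mul_le_mul_of_nonneg_left (hbd p) (abs_nonneg _)
  have hpt : ∀ p, |f p - m| ^ T ≤
      (T ! * b ^ T) * (Real.exp (b⁻¹ * (f p - m)) + Real.exp (-b⁻¹ * (f p - m))) := by
    intro p
    set u := b⁻¹ * (f p - m) with hu
    have h1 : |f p - m| = b * |u| := by
      rw [hu, abs_mul, abs_of_pos (inv_pos.2 hb0), mul_inv_cancel_left₀ hb0.ne']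
    have h2 : |u| ^ T / T ! ≤ Real.exp |u| := Real.pow_div_factorial_le_exp _ (abs_nonneg _) _
    have h3 : Real.exp |u| ≤ Real.exp u + Real.exp (-u) := by
      rcases abs_cases u with ⟨h, _⟩ | ⟨h, _⟩ <;> rw [h]
      · linarith [Real.exp_pos (-u)]
      · linarith [Real.exp_pos u]
    have hT : (0 : ℝ) < T ! := by exact_mod_cast Nat.factorial_pos T
    have h4 : |u| ^ T ≤ T ! * (Real.exp u + Real.exp (-u)) := by
      rw [div_le_iff₀ hT] at h2
      nlinarith
    rw [h1, mul_pow, neg_mul]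
    calc b ^ T * |u| ^ T ≤ b ^ T * (T ! * (Real.exp u + Real.exp (-u))) := by gcongr
      _ = _ := by ring
  have hmono := integral_mono_of_nonneg (μ := Measure.pi fun _ : Fin n => ν)
    (Eventually.of_forall fun p => pow_nonneg (abs_nonneg (f p - m)) T)
    (((hexp b⁻¹).add (hexp (-b⁻¹))).const_mul (T ! * b ^ T)) (Eventually.of_forall hpt)
  refine hmono.trans ?_
  have hval : ∀ t : ℝ, t ^ 2 = (b ^ 2)⁻¹ →
      ∫ p, Real.exp (t * (f p - m)) ∂(Measure.pi fun _ => ν) ≤ Real.exp (1 / 2) := by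
    intro t ht
    refine (integral_exp_le_of_bounded_differences ν t n hf hB hc).trans (le_of_eq ?_)
    congr 1
    rw [ht, hb, mul_pow, Real.sq_sqrt (Nat.cast_nonneg n)]
    have : (n : ℝ) ≠ 0 := by exact_mod_cast hn.ne'
    field_simp
  rw [integral_const_mul]
  simp only [Pi.add_apply]
  rw [integral_add (hexp _) (hexp _)]
  have e1 := hval b⁻¹ (by rw [inv_pow])
  have e2 := hval (-b⁻¹) (by rw [neg_sq, inv_pow])
  calc (T ! * b ^ T) * ((∫ p, Real.exp (b⁻¹ * (f p - m)) ∂(Measure.pi fun _ => ν)) +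
        ∫ p, Real.exp (-b⁻¹ * (f p - m)) ∂(Measure.pi fun _ => ν))
      ≤ (T ! * b ^ T) * (Real.exp (1 / 2) + Real.exp (1 / 2)) := by gcongr
    _ = _ := by ring

variable {k : ℕ} {h : (Fin k → I) → ℝ}

theorem integral_abs_vStat_sub_pow_le (hm : Measurable h) (hb : ∀ q, |h q| ≤ 1) (hk : 0 < k)
    (hn : 0 < n) (T : ℕ) :
    ∫ p : Fin n → I, |vStat h p - ∫ q : Fin n → I, vStat h q ∂(Measure.pi fun _ => ν)| ^ T
      ∂(Measure.pi fun _ => ν) ≤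
      2 * T ! * Real.exp (1 / 2) * (2 * k * (n : ℝ) ^ (k - 1) * √n) ^ T :=
  integral_abs_sub_pow_le_of_bounded_differences ν (by positivity) hn (measurable_vStat hm)
    (abs_vStat_le hb) (abs_vStat_update_sub_le hb) T

end BoundedDifferences

/-! ### Characteristic functions of normalized sums -/

section CentralLimit

variable {I : Type*} [MeasurableSpace I] (ν : Measure I) [IsProbabilityMeasure ν]

theorem integral_cexp_sum_eq_pow (g : I → ℝ) (r : ℝ) (n : ℕ) :
    ∫ p : Fin n → I, Complex.exp (↑(r * ∑ j, g (p j)) * Complex.I) ∂(Measure.pi fun _ => ν) =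
      (∫ x, Complex.exp (↑(r * g x) * Complex.I) ∂ν) ^ n := by
  have h := integral_fintype_prod_eq_pow (ι := Fin n) (μ := ν)
    (fun x => Complex.exp (↑(r * g x) * Complex.I))
  rw [Fintype.card_fin] at h
  rw [← h]
  refine integral_congr_ae (Eventually.of_forall fun p => ?_)
  simp only
  rw [← Complex.exp_sum, ← Finset.sum_mul, Finset.mul_sum]
  push_cast
  rfl

/-- The central limit theorem for sums of a centered function of independent variables, in terms of
characteristic functions; the variance may vanish. -/
theorem tendsto_integral_cexp_inv_sqrt_mul_sum {g : I → ℝ} (hg : Measurable g) {C : ℝ}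
    (hC : ∀ x, |g x| ≤ C) (h0 : ∫ x, g x ∂ν = 0) :
    Tendsto (fun n : ℕ => ∫ p : Fin n → I, Complex.exp (↑((√n)⁻¹ * ∑ j, g (p j)) * Complex.I)
      ∂(Measure.pi fun _ => ν)) atTop (𝓝 (Complex.exp (-↑(∫ x, g x ^ 2 ∂ν) / 2))) := by
  have hi2 : Integrable (fun x => g x ^ 2) ν :=
    integrable_of_measurable_of_abs_le (C := C ^ 2) (by fun_prop) fun x => by
      rw [abs_pow]; exact pow_le_pow_left₀ (abs_nonneg _) (hC x) 2
  simp only [integral_cexp_sum_eq_pow]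
  set v := ∫ x, g x ^ 2 ∂ν with hv
  rcases (integral_nonneg fun x => sq_nonneg (g x) : 0 ≤ v).eq_or_lt with h | h
  · have hg0 : ∀ᵐ x ∂ν, g x = 0 := by
      have := (integral_eq_zero_iff_of_nonneg (fun x => sq_nonneg (g x)) hi2).1 (hv ▸ h.symm)
      filter_upwards [this] with x hx
      simpa using hx
    have h1 : ∀ r : ℝ, ∫ x, Complex.exp (↑(r * g x) * Complex.I) ∂ν = 1 := by
      intro r
      rw [integral_congr_ae (g := fun _ => (1 : ℂ)) (by
        filter_upwards [hg0] with x hx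
        simp [hx])]
      simp
    simp only [h1, hv, ← h]
    simp
  · have hs : √v ≠ 0 := (Real.sqrt_pos.2 h).ne'
    have key := tendsto_charFun_inv_sqrt_mul_pow (P := ν) (X := fun x => g x / √v)
      (by fun_prop) (by rw [integral_div, h0, zero_div]) (by
        simp only [Pi.pow_apply, div_pow]
        rw [integral_div, Real.sq_sqrt h.le, ← hv, div_self h.ne']) (√v)
    have h2 : Complex.exp (-(√v : ℂ) ^ 2 / 2) = Complex.exp (-(v : ℂ) / 2) := by
      rw [← Complex.ofReal_pow, Real.sq_sqrt h.le]
    rw [h2] at key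
    refine key.congr fun n => ?_
    congr 1
    rw [charFun_apply_real, integral_map (by fun_prop) (by fun_prop)]
    refine integral_congr_ae (Eventually.of_forall fun x => ?_)
    simp only
    congr 2
    rw [← Complex.ofReal_mul]
    congr 1
    field_simp

end CentralLimit

/-! ### Order simplices -/

section Simplex

/-- The uniform law on the unit interval. The half-open interval matches the convention of interval
integrals. -/
noncomputable def unitMeasure : Measure ℝ := volume.restrict (Set.Ioc 0 1)

instance : IsProbabilityMeasure unitMeasure := ⟨by simp [unitMeasure]⟩

open Classical in
/-- The indicator function of the strictly increasing tuples. -/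
noncomputable def strictMonoInd {k : ℕ} (q : Fin k → ℝ) : ℝ := if StrictMono q then 1 else 0

variable {k : ℕ}

theorem measurableSet_strictMono : MeasurableSet {q : Fin k → ℝ | StrictMono q} := by
  have : {q : Fin k → ℝ | StrictMono q} =
      ⋂ i : Fin k, ⋂ j : Fin k, {q | i < j → q i < q j} := by
    ext q
    simp [StrictMono]
  rw [this]
  refine MeasurableSet.iInter fun i => MeasurableSet.iInter fun j => ?_
  by_cases hij : i < j
  · simpa [hij] using measurableSet_lt (measurable_pi_apply i) (measurable_pi_apply j)
  · simp [hij]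

@[fun_prop]
theorem measurable_strictMonoInd : Measurable (strictMonoInd : (Fin k → ℝ) → ℝ) :=
  Measurable.ite measurableSet_strictMono measurable_const measurable_const

theorem abs_strictMonoInd_le (q : Fin k → ℝ) : |strictMonoInd q| ≤ 1 := by
  unfold strictMonoInd
  split_ifs <;> simp

theorem strictMonoInd_cons_cons (lo t : ℝ) (q : Fin k → ℝ) :
    strictMonoInd (Fin.cons lo (Fin.cons t q : Fin (k + 1) → ℝ) : Fin (k + 2) → ℝ) =
      if lo < t then strictMonoInd (Fin.cons t q : Fin (k + 1) → ℝ) else 0 := by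
  have h : StrictMono (Fin.cons lo (Fin.cons t q : Fin (k + 1) → ℝ) : Fin (k + 2) → ℝ) ↔
      lo < t ∧ StrictMono (Fin.cons t q : Fin (k + 1) → ℝ) := strictMono_vecCons
  unfold strictMonoInd
  by_cases h1 : lo < t <;> simp [h, h1]

theorem integral_unitMeasure_ite_le {lo u : ℝ} (h0 : 0 ≤ lo) (hlu : lo ≤ u) (h1 : u ≤ 1)
    (F : ℝ → ℝ) :
    ∫ t, (if lo < t ∧ t ≤ u then F t else 0) ∂unitMeasure = ∫ t in lo..u, F t := by
  rw [intervalIntegral.integral_of_le hlu, unitMeasure]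
  have h2 : (fun t => if lo < t ∧ t ≤ u then F t else 0) = (Set.Ioc lo u).indicator F := by
    funext t
    simp [Set.indicator_apply, Set.mem_Ioc]
  rw [h2, integral_indicator measurableSet_Ioc, Measure.restrict_restrict measurableSet_Ioc,
    Set.inter_eq_left.2 (Set.Ioc_subset_Ioc h0 h1)]

theorem integral_unitMeasure_ite_lt {lo u : ℝ} (h0 : 0 ≤ lo) (hlu : lo ≤ u) (h1 : u ≤ 1)
    (F : ℝ → ℝ) :
    ∫ t, (if lo < t ∧ t < u then F t else 0) ∂unitMeasure = ∫ t in lo..u, F t := by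
  rw [intervalIntegral.integral_of_le hlu, integral_Ioc_eq_integral_Ioo, unitMeasure]
  have h2 : (fun t => if lo < t ∧ t < u then F t else 0) = (Set.Ioo lo u).indicator F := by
    funext t
    simp [Set.indicator_apply, Set.mem_Ioo]
  rw [h2, integral_indicator measurableSet_Ioo, Measure.restrict_restrict measurableSet_Ioo,
    Set.inter_eq_left.2 (Set.Ioo_subset_Ioc_self.trans (Set.Ioc_subset_Ioc h0 h1))]

theorem ae_unitMeasure_mem : ∀ᵐ t ∂unitMeasure, t ∈ Set.Ioc (0 : ℝ) 1 :=
  ae_restrict_mem measurableSet_Ioc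

theorem integral_sub_pow_div_factorial (lo u : ℝ) (m : ℕ) :
    ∫ t in lo..u, (u - t) ^ m / (m ! : ℝ) = (u - lo) ^ (m + 1) / ((m + 1)! : ℝ) := by
  rw [intervalIntegral.integral_div, intervalIntegral.integral_comp_sub_left (fun t => t ^ m) u,
    integral_pow, Nat.factorial_succ]
  have : (m ! : ℝ) ≠ 0 := by exact_mod_cast m.factorial_ne_zero
  push_cast
  field_simp
  simp

/-- The volume of the order simplex over `(lo, 1)`. -/
theorem integral_strictMonoInd_cons (k : ℕ) : ∀ {lo : ℝ}, 0 ≤ lo → lo ≤ 1 →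
    ∫ q : Fin k → ℝ, strictMonoInd (Fin.cons lo q : Fin (k + 1) → ℝ)
      ∂(Measure.pi fun _ => unitMeasure) = (1 - lo) ^ k / (k ! : ℝ) := by
  induction k with
  | zero =>
    intro lo _ _
    have : ∀ q : Fin 1 → ℝ, strictMonoInd q = 1 := fun q => by
      simp [strictMonoInd, Subsingleton.strictMono]
    simp [this]
  | succ k ih =>
    intro lo h0 h1
    have hcons : Measurable fun q : Fin (k + 1) → ℝ => (Fin.cons lo q : Fin (k + 2) → ℝ) :=
      (measurePreserving_fin_cons unitMeasure (k + 1)).measurable.comp measurable_prodMk_left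
    have hmeas : Measurable fun q : Fin (k + 1) → ℝ =>
        strictMonoInd (Fin.cons lo q : Fin (k + 2) → ℝ) := measurable_strictMonoInd.comp hcons
    rw [integral_pi_succ unitMeasure hmeas (fun q => abs_strictMonoInd_le _)]
    rw [← integral_sub_pow_div_factorial, ← integral_unitMeasure_ite_le h0 h1 le_rfl]
    refine integral_congr_ae ?_
    filter_upwards [ae_unitMeasure_mem] with t ht
    simp only [strictMonoInd_cons_cons]
    by_cases hlt : lo < t
    · simp only [hlt, if_true, ht.2, and_self]
      exact ih ht.1.le ht.2
    · simp [hlt]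

theorem measurable_cons_update (lo u : ℝ) (b : Fin k) :
    Measurable fun q : Fin k → ℝ => (Fin.cons lo (Function.update q b u) : Fin (k + 1) → ℝ) :=
  ((measurePreserving_fin_cons unitMeasure k).measurable.comp measurable_prodMk_left).comp
    measurable_update_left

theorem integral_strictMonoInd_cons_update_zero (k : ℕ) {lo u : ℝ} (h0 : 0 ≤ u) (h1 : u ≤ 1) :
    ∫ q : Fin (k + 1) → ℝ, strictMonoInd (Fin.cons lo (Function.update q 0 u) : Fin (k + 2) → ℝ)
      ∂(Measure.pi fun _ => unitMeasure) =
      if lo < u then (1 - u) ^ k / (k ! : ℝ) else 0 := by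
  rw [integral_pi_succ unitMeasure
    (f := fun q => strictMonoInd (Fin.cons lo (Function.update q 0 u) : Fin (k + 2) → ℝ))
    (measurable_strictMonoInd.comp (measurable_cons_update lo u 0))
    (fun q => abs_strictMonoInd_le _)]
  simp only [Fin.update_cons_zero, strictMonoInd_cons_cons]
  by_cases hlu : lo < u
  · simp [hlu, integral_strictMonoInd_cons k h0 h1]
  · simp [hlu]

/-- The volume of the order simplex over `(lo, 1)` with the coordinate `b` pinned to `u`. -/
theorem integral_strictMonoInd_cons_update (k : ℕ) : ∀ (b : Fin (k + 1)) {lo u : ℝ}, 0 ≤ lo →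
    lo ≤ 1 → 0 ≤ u → u ≤ 1 →
    ∫ q : Fin (k + 1) → ℝ, strictMonoInd (Fin.cons lo (Function.update q b u) : Fin (k + 2) → ℝ)
      ∂(Measure.pi fun _ => unitMeasure) =
      if lo < u then (u - lo) ^ (b : ℕ) / ((b : ℕ)! : ℝ) * ((1 - u) ^ (k - b) / ((k - b)! : ℝ))
        else 0 := by
  induction k with
  | zero =>
    intro b lo u h0 h1 h2 h3
    obtain rfl : b = 0 := Fin.fin_one_eq_zero b
    simpa using integral_strictMonoInd_cons_update_zero 0 h2 h3
  | succ k ih =>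
    intro b lo u h0 h1 h2 h3
    refine Fin.cases ?_ (fun b => ?_) b
    · simpa using integral_strictMonoInd_cons_update_zero (k + 1) h2 h3
    · rw [integral_pi_succ unitMeasure
        (f := fun q => strictMonoInd (Fin.cons lo (Function.update q b.succ u) : Fin (k + 3) → ℝ))
        (measurable_strictMonoInd.comp (measurable_cons_update lo u b.succ))
        (fun q => abs_strictMonoInd_le _)]
      simp only [← Fin.cons_update, strictMonoInd_cons_cons, Fin.val_succ]
      have hstep : ∀ᵐ t ∂unitMeasure, (∫ q : Fin (k + 1) → ℝ, (if lo < t then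
          strictMonoInd (Fin.cons t (Function.update q b u) : Fin (k + 2) → ℝ) else 0)
          ∂(Measure.pi fun _ => unitMeasure)) = if lo < t ∧ t < u then
            (u - t) ^ (b : ℕ) / ((b : ℕ)! : ℝ) * ((1 - u) ^ (k - b) / ((k - b)! : ℝ)) else 0 := by
        filter_upwards [ae_unitMeasure_mem] with t ht
        by_cases hlt : lo < t
        · simp only [hlt, if_true, true_and]
          exact ih b ht.1.le ht.2 h2 h3
        · simp [hlt]
      rw [integral_congr_ae hstep, Nat.add_sub_add_right]
      by_cases hlu : lo < u
      · rw [if_pos hlu, integral_unitMeasure_ite_lt h0 hlu.le h3,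
          intervalIntegral.integral_mul_const, integral_sub_pow_div_factorial]
      · rw [if_neg hlu]
        have : ∀ t : ℝ, ¬ (lo < t ∧ t < u) := fun t h => hlu (h.1.trans h.2)
        simp [this]

/-- The density at `u` of the event that uniform variables are increasing, when the variable `b` is
pinned to `u`. -/
theorem integral_strictMonoInd_update (b : Fin k) {u : ℝ} (h0 : 0 ≤ u) (h1 : u ≤ 1) :
    ∫ q : Fin k → ℝ, strictMonoInd (Function.update q b u) ∂(Measure.pi fun _ => unitMeasure) =
      bernsteinPoly k (b + 1) u / ((k - 1)! : ℝ) := by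
  obtain _ | k := k
  · exact b.elim0
  have hval : bernsteinPoly (k + 1) (b + 1) u / ((k + 1 - 1)! : ℝ) =
      u ^ (b : ℕ) / ((b : ℕ)! : ℝ) * ((1 - u) ^ (k - b) / ((k - b)! : ℝ)) := by
    rw [bernsteinPoly]
    simp only [Nat.add_sub_cancel, Nat.add_sub_add_right]
    rw [Nat.cast_choose ℝ (Nat.lt_succ_iff.1 b.2)]
    have e1 : (k ! : ℝ) ≠ 0 := by exact_mod_cast k.factorial_ne_zero
    field_simp
  rw [hval]
  have hmeas : Measurable fun q : Fin (k + 1) → ℝ => strictMonoInd (Function.update q b u) :=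
    measurable_strictMonoInd.comp measurable_update_left
  rw [integral_pi_succ unitMeasure hmeas (fun q => abs_strictMonoInd_le _)]
  clear hmeas hval
  refine Fin.cases ?_ (fun b => ?_) b
  · simp [Fin.update_cons_zero, integral_strictMonoInd_cons k h0 h1]
  · obtain _ | k := k
    · exact b.elim0
    simp only [← Fin.cons_update, Fin.val_succ, Nat.add_sub_add_right]
    have hstep : ∀ᵐ t ∂unitMeasure, (∫ q : Fin (k + 1) → ℝ,
        strictMonoInd (Fin.cons t (Function.update q b u) : Fin (k + 2) → ℝ)
        ∂(Measure.pi fun _ => unitMeasure)) = if 0 < t ∧ t < u then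
          (u - t) ^ (b : ℕ) / ((b : ℕ)! : ℝ) * ((1 - u) ^ (k - b) / ((k - b)! : ℝ)) else 0 := by
      filter_upwards [ae_unitMeasure_mem] with t ht
      simp only [ht.1, true_and]
      exact integral_strictMonoInd_cons_update k b ht.1.le ht.2 h0 h1
    rw [integral_congr_ae hstep, integral_unitMeasure_ite_lt le_rfl h0 h1,
      intervalIntegral.integral_mul_const, integral_sub_pow_div_factorial, sub_zero]

theorem integral_strictMonoInd (k : ℕ) :
    ∫ q : Fin k → ℝ, strictMonoInd q ∂(Measure.pi fun _ => unitMeasure) = 1 / (k ! : ℝ) := by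
  obtain _ | k := k
  · have : ∀ q : Fin 0 → ℝ, strictMonoInd q = 1 := fun q => by
      simp [strictMonoInd, Subsingleton.strictMono]
    simp [this]
  rw [integral_pi_succ unitMeasure measurable_strictMonoInd abs_strictMonoInd_le]
  have hstep : ∀ᵐ t ∂unitMeasure, (∫ q : Fin k → ℝ,
      strictMonoInd (Fin.cons t q : Fin (k + 1) → ℝ) ∂(Measure.pi fun _ => unitMeasure)) =
      if 0 < t ∧ t ≤ 1 then (1 - t) ^ k / (k ! : ℝ) else 0 := by
    filter_upwards [ae_unitMeasure_mem] with t ht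
    rw [if_pos (Set.mem_Ioc.1 ht)]
    exact integral_strictMonoInd_cons k ht.1.le ht.2
  rw [integral_congr_ae hstep, integral_unitMeasure_ite_le le_rfl zero_le_one le_rfl,
    integral_sub_pow_div_factorial]
  simp

end Simplex

/-! ### The kernel of a pattern -/

section PatternKernel

/-- The uniform law on the unit square. -/
noncomputable abbrev squareMeasure : Measure (ℝ × ℝ) := unitMeasure.prod unitMeasure

/-- The indicator that the points `q` are listed by increasing first coordinate and that their
second coordinates form the pattern `σ`. -/
noncomputable def patternInd (σ : Pattern) (q : Fin σ.len → ℝ × ℝ) : ℝ :=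
  strictMonoInd (fun a => (q a).1) * strictMonoInd (fun a => (q (σ.perm.symm a)).2)

variable (σ : Pattern)

@[fun_prop]
theorem measurable_patternInd : Measurable (patternInd σ) := by
  unfold patternInd
  exact (measurable_strictMonoInd.comp (by fun_prop)).mul
    (measurable_strictMonoInd.comp (by fun_prop))

theorem abs_patternInd_le (q : Fin σ.len → ℝ × ℝ) : |patternInd σ q| ≤ 1 := by
  rw [patternInd, abs_mul]
  exact mul_le_one₀ (abs_strictMonoInd_le _) (abs_nonneg _) (abs_strictMonoInd_le _)

theorem integral_pi_prod_mul {ι : Type*} [Fintype ι] {μ μ' : Measure ℝ} [IsProbabilityMeasure μ]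
    [IsProbabilityMeasure μ'] {f g : (ι → ℝ) → ℝ} (hf : Measurable f) (hg : Measurable g) :
    ∫ q : ι → ℝ × ℝ, f (fun a => (q a).1) * g (fun a => (q a).2)
      ∂(Measure.pi fun _ => μ.prod μ') =
      (∫ x, f x ∂(Measure.pi fun _ => μ)) * ∫ y, g y ∂(Measure.pi fun _ => μ') := by
  rw [← integral_prod_mul]
  exact integral_comp_measurePreserving
    (measurePreserving_arrowProdEquivProdArrow ℝ ℝ ι (fun _ => μ) (fun _ => μ'))
    (g := fun z : (ι → ℝ) × (ι → ℝ) => f z.1 * g z.2)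
    ((hf.comp measurable_fst).mul (hg.comp measurable_snd)).aestronglyMeasurable

theorem kernelMean_patternInd :
    kernelMean squareMeasure (patternInd σ) = 1 / (σ.len ! : ℝ) ^ 2 := by
  have h : ∫ y : Fin σ.len → ℝ, strictMonoInd (fun a => y (σ.perm.symm a))
      ∂(Measure.pi fun _ => unitMeasure) = 1 / (σ.len ! : ℝ) := by
    rw [← integral_strictMonoInd]
    exact integral_comp_measurePreserving
      (measurePreserving_comp_injective unitMeasure σ.perm.symm.injective)
      measurable_strictMonoInd.aestronglyMeasurable
  unfold kernelMean patternInd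
  rw [integral_pi_prod_mul (f := strictMonoInd)
    (g := fun y => strictMonoInd (fun a => y (σ.perm.symm a))) measurable_strictMonoInd
    (measurable_strictMonoInd.comp (by fun_prop)), h, integral_strictMonoInd]
  ring

theorem condMean_patternInd (a : Fin σ.len) {x y : ℝ} (hx : x ∈ Set.Ioc (0 : ℝ) 1)
    (hy : y ∈ Set.Ioc (0 : ℝ) 1) :
    condMean squareMeasure (patternInd σ) a (x, y) =
      bernsteinPoly σ.len (a + 1) x * bernsteinPoly σ.len (σ.perm a + 1) y /
        ((σ.len - 1)! : ℝ) ^ 2 := by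
  have h1 : ∀ q : Fin σ.len → ℝ × ℝ, patternInd σ (Function.update q a (x, y)) =
      strictMonoInd (Function.update (fun c => (q c).1) a x) *
        strictMonoInd (fun c => Function.update (fun c => (q c).2) a y (σ.perm.symm c)) := by
    intro q
    unfold patternInd
    congr 2
    · funext c
      by_cases hc : c = a
      · subst hc; simp
      · simp [hc]
    · funext c
      by_cases hc : σ.perm.symm c = a
      · subst hc; simp
      · simp [hc]
  have h2 : ∀ z : Fin σ.len → ℝ, (fun c => Function.update z a y (σ.perm.symm c)) =
      Function.update (fun c => z (σ.perm.symm c)) (σ.perm a) y := by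
    intro z
    funext c
    by_cases hc : c = σ.perm a
    · subst hc; simp
    · rw [Function.update_of_ne hc, Function.update_of_ne]
      intro h
      exact hc (by rw [← h, Equiv.apply_symm_apply])
  have h3 : ∫ z : Fin σ.len → ℝ,
      strictMonoInd (fun c => Function.update z a y (σ.perm.symm c))
      ∂(Measure.pi fun _ => unitMeasure) =
      bernsteinPoly σ.len (σ.perm a + 1) y / ((σ.len - 1)! : ℝ) := by
    rw [← integral_strictMonoInd_update (σ.perm a) hy.1.le hy.2]
    simp only [h2]
    exact integral_comp_measurePreserving
      (measurePreserving_comp_injective unitMeasure σ.perm.symm.injective)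
      (g := fun z => strictMonoInd (Function.update z (σ.perm a) y))
      (measurable_strictMonoInd.comp measurable_update_left).aestronglyMeasurable
  have h4 : Measurable fun z : Fin σ.len → ℝ =>
      strictMonoInd (fun c => Function.update z a y (σ.perm.symm c)) := by
    simp only [h2]
    exact measurable_strictMonoInd.comp (measurable_update_left.comp (by fun_prop))
  unfold condMean
  simp only [h1]
  rw [integral_pi_prod_mul (f := fun z => strictMonoInd (Function.update z a x))
    (g := fun z => strictMonoInd (fun c => Function.update z a y (σ.perm.symm c)))
    (measurable_strictMonoInd.comp measurable_update_left) h4, h3,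
    integral_strictMonoInd_update a hx.1.le hx.2]
  ring

theorem ae_squareMeasure_mem :
    ∀ᵐ z ∂squareMeasure, z.1 ∈ Set.Ioc (0 : ℝ) 1 ∧ z.2 ∈ Set.Ioc (0 : ℝ) 1 :=
  (Measure.quasiMeasurePreserving_fst.ae ae_unitMeasure_mem).and
    (Measure.quasiMeasurePreserving_snd.ae ae_unitMeasure_mem)

/-- The linear part of the indicator of an occurrence of `σ` is the kernel `G_σ`. -/
theorem linearPart_patternInd_ae_eq :
    linearPart squareMeasure (patternInd σ) =ᵐ[squareMeasure] fun z => patternKernel σ z.1 z.2 := by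
  filter_upwards [ae_squareMeasure_mem] with z hz
  have hk : (σ.len : ℝ) ≠ 0 := by
    exact_mod_cast (Nat.lt_of_lt_of_le Nat.zero_lt_one σ.one_le_len).ne'
  have hf : (σ.len ! : ℝ) = σ.len * ((σ.len - 1)! : ℝ) := by
    rw [← Nat.mul_factorial_pred (by have := σ.one_le_len; omega)]
    push_cast; rfl
  have hf0 : ((σ.len - 1)! : ℝ) ≠ 0 := by exact_mod_cast (σ.len - 1).factorial_ne_zero
  have h1 : ∀ a, condMean squareMeasure (patternInd σ) a z =
      bernsteinPoly σ.len (a + 1) z.1 * bernsteinPoly σ.len (σ.perm a + 1) z.2 /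
        ((σ.len - 1)! : ℝ) ^ 2 := fun a => condMean_patternInd σ a hz.1 hz.2
  simp only [linearPart, patternKernel, h1, kernelMean_patternInd]
  rw [Finset.sum_sub_distrib, ← Finset.sum_div, hf]
  simp only [Finset.sum_const, Finset.card_univ, Fintype.card_fin, nsmul_eq_mul]
  field_simp

theorem integrable_linearPart_mul (σ τ : Pattern) :
    Integrable (fun z => linearPart squareMeasure (patternInd σ) z *
      linearPart squareMeasure (patternInd τ) z) squareMeasure := by
  refine integrable_of_measurable_of_abs_le
    ((measurable_linearPart squareMeasure (measurable_patternInd σ)).mul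
      (measurable_linearPart squareMeasure (measurable_patternInd τ)))
    (C := 2 * σ.len * (2 * τ.len)) fun z => ?_
  rw [abs_mul]
  exact mul_le_mul (abs_linearPart_le _ (abs_patternInd_le σ) z)
    (abs_linearPart_le _ (abs_patternInd_le τ) z) (abs_nonneg _) (by positivity)

theorem limitCov_eq_integral (σ τ : Pattern) :
    limitCov σ τ = ∫ z, linearPart squareMeasure (patternInd σ) z *
      linearPart squareMeasure (patternInd τ) z ∂squareMeasure := by
  have hae : (fun z => linearPart squareMeasure (patternInd σ) z *
      linearPart squareMeasure (patternInd τ) z) =ᵐ[squareMeasure]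
      fun z => patternKernel σ z.1 z.2 * patternKernel τ z.1 z.2 := by
    filter_upwards [linearPart_patternInd_ae_eq σ, linearPart_patternInd_ae_eq τ] with z h1 h2
    rw [h1, h2]
  have hint : Integrable (fun z : ℝ × ℝ => patternKernel σ z.1 z.2 * patternKernel τ z.1 z.2)
      squareMeasure := (integrable_linearPart_mul σ τ).congr hae
  rw [integral_congr_ae hae, integral_prod _ hint, limitCov,
    intervalIntegral.integral_of_le zero_le_one]
  simp only [intervalIntegral.integral_of_le (zero_le_one (α := ℝ))]
  rfl

/-- The limit variance of a linear combination of counts is the second moment of the combined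
linear part. -/
theorem integral_sum_linearPart_sq {ι : Type*} [Fintype ι] (σ : ι → Pattern) (c : ι → ℝ) :
    ∫ z, (∑ i, c i * linearPart squareMeasure (patternInd (σ i)) z) ^ 2 ∂squareMeasure =
      ∑ i, ∑ j, c i * c j * limitCov (σ i) (σ j) := by
  have hint : ∀ i j, Integrable (fun z => c i * c j *
      (linearPart squareMeasure (patternInd (σ i)) z *
        linearPart squareMeasure (patternInd (σ j)) z)) squareMeasure :=
    fun i j => (integrable_linearPart_mul (σ i) (σ j)).const_mul _
  have h1 : ∀ z, (∑ i, c i * linearPart squareMeasure (patternInd (σ i)) z) ^ 2 =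
      ∑ i, ∑ j, c i * c j * (linearPart squareMeasure (patternInd (σ i)) z *
        linearPart squareMeasure (patternInd (σ j)) z) := by
    intro z
    rw [pow_two, Finset.sum_mul_sum]
    exact Finset.sum_congr rfl fun i _ => Finset.sum_congr rfl fun j _ => by ring
  simp only [h1]
  rw [integral_finsetSum _ fun i _ => integrable_finsetSum _ fun j _ => hint i j]
  refine Finset.sum_congr rfl fun i _ => ?_
  rw [integral_finsetSum _ fun j _ => hint i j]
  refine Finset.sum_congr rfl fun j _ => ?_
  rw [integral_const_mul, limitCov_eq_integral]

theorem posSemidef_limitCov {ι : Type*} [Fintype ι] (σ : ι → Pattern) :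
    (Matrix.of fun i j => limitCov (σ i) (σ j)).PosSemidef := by
  refine Matrix.PosSemidef.of_dotProduct_mulVec_nonneg ?_ fun c => ?_
  · ext i j
    simp only [Matrix.conjTranspose_apply, Matrix.of_apply, star_trivial]
    rw [limitCov_eq_integral, limitCov_eq_integral]
    simp only [mul_comm]
  · have h : star c ⬝ᵥ (Matrix.of fun i j => limitCov (σ i) (σ j)).mulVec c =
        ∑ i, ∑ j, c i * c j * limitCov (σ i) (σ j) := by
      simp only [dotProduct, Matrix.mulVec, Matrix.of_apply, Pi.star_apply, star_trivial,
        Finset.mul_sum]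
      exact Finset.sum_congr rfl fun i _ => Finset.sum_congr rfl fun j _ => by ring
    rw [h, ← integral_sum_linearPart_sq]
    exact integral_nonneg fun z => sq_nonneg _

end PatternKernel

/-! ### Uniform permutations from random points -/

section Coupling

variable {n : ℕ}

theorem uniformPerm_singleton (π : Equiv.Perm (Fin n)) : uniformPerm n {π} = (n ! : ENNReal)⁻¹ := by
  rw [uniformPerm, uniformOn_univ]
  simp [Fintype.card_perm]

theorem eq_uniformPerm_of_forall_singleton_eq {μ : Measure (Equiv.Perm (Fin n))}
    [IsProbabilityMeasure μ] (h : ∀ π, μ {π} = μ {1}) : μ = uniformPerm n := by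
  have h1 : (n ! : ENNReal) * μ {1} = 1 := by
    have := measure_univ (μ := μ)
    rw [← Finset.coe_univ, ← sum_measure_singleton, Finset.sum_congr rfl fun π _ => h π,
      Finset.sum_const, Finset.card_univ, Fintype.card_perm, Fintype.card_fin, nsmul_eq_mul] at this
    exact this
  refine Measure.ext_of_singleton fun π => ?_
  rw [uniformPerm_singleton, h]
  exact ENNReal.eq_inv_of_mul_eq_one_left (by rw [mul_comm]; exact h1)

theorem measurable_tuple_sort :
    Measurable (Tuple.sort : (Fin n → ℝ) → Equiv.Perm (Fin n)) := by
  refine measurable_to_countable' fun τ => ?_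
  have h : (Tuple.sort : (Fin n → ℝ) → Equiv.Perm (Fin n)) ⁻¹' {τ} =
      (⋂ i : Fin n, ⋂ j : Fin n, {f | i ≤ j → f (τ i) ≤ f (τ j)}) ∩
        ⋂ i : Fin n, ⋂ j : Fin n, {f | i < j → f (τ i) = f (τ j) → τ i < τ j} := by
    ext f
    rw [Set.mem_preimage, Set.mem_singleton_iff, eq_comm, Tuple.eq_sort_iff]
    simp [Monotone]
  rw [h]
  refine (MeasurableSet.iInter fun i => MeasurableSet.iInter fun j => ?_).inter
    (MeasurableSet.iInter fun i => MeasurableSet.iInter fun j => ?_)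
  · by_cases hij : i ≤ j
    · simpa [hij] using measurableSet_le (measurable_pi_apply (τ i)) (measurable_pi_apply (τ j))
    · simp [hij]
  · by_cases hij : i < j ∧ ¬ τ i < τ j
    · have : {f : Fin n → ℝ | i < j → f (τ i) = f (τ j) → τ i < τ j} =
          {f | f (τ i) = f (τ j)}ᶜ := by
        ext f; simp [hij.1, hij.2]
      rw [this]
      exact (measurableSet_eq_fun (measurable_pi_apply (τ i)) (measurable_pi_apply (τ j))).compl
    · have : {f : Fin n → ℝ | i < j → f (τ i) = f (τ j) → τ i < τ j} = Set.univ := by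
        ext f
        simp only [Set.mem_ofPred_eq, Set.mem_univ, iff_true]
        intro h1 _
        by_contra h2
        exact hij ⟨h1, h2⟩
      rw [this]
      exact MeasurableSet.univ

theorem ae_injective_pi_unitMeasure :
    ∀ᵐ y ∂(Measure.pi fun _ : Fin n => unitMeasure), Function.Injective y := by
  have h : ∀ i j : Fin n, i ≠ j → ∀ᵐ y ∂(Measure.pi fun _ : Fin n => unitMeasure), y i ≠ y j := by
    intro i j hij
    have hmp := measurePreserving_piecewise unitMeasure ({i} : Finset (Fin n))
    have hset : MeasurableSet {y : Fin n → ℝ | y i = y j} :=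
      measurableSet_eq_fun (measurable_pi_apply i) (measurable_pi_apply j)
    rw [ae_iff]
    simp only [ne_eq, not_not]
    rw [← hmp.measure_preimage hset.nullMeasurableSet,
      Measure.prod_apply (hmp.measurable hset)]
    refine (lintegral_congr fun p => ?_).trans (lintegral_zero)
    have : Prod.mk p ⁻¹' ((fun z : (Fin n → ℝ) × (Fin n → ℝ) =>
        ({i} : Finset (Fin n)).piecewise z.1 z.2) ⁻¹' {y | y i = y j}) =
        (Function.eval j : (Fin n → ℝ) → ℝ) ⁻¹' ({p i} : Set ℝ) := by
      ext p'
      simp [Finset.piecewise_singleton, Function.update_of_ne hij.symm, eq_comm]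
    rw [this, (measurePreserving_eval (fun _ : Fin n => unitMeasure) j).measure_preimage
      (measurableSet_singleton _).nullMeasurableSet]
    have : NullSingletonClass unitMeasure := by unfold unitMeasure; infer_instance
    exact measure_singleton _
  have h2 : ∀ᵐ y ∂(Measure.pi fun _ : Fin n => unitMeasure), ∀ i j, i ≠ j → y i ≠ y j := by
    simp only [ae_all_iff]
    exact h
  filter_upwards [h2] with y hy i j hij
  by_contra hne
  exact hy i j hne hij

theorem map_tuple_sort_pi :
    (Measure.pi fun _ : Fin n => unitMeasure).map Tuple.sort = uniformPerm n := by
  have : IsProbabilityMeasure ((Measure.pi fun _ : Fin n => unitMeasure).map Tuple.sort) :=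
    Measure.isProbabilityMeasure_map measurable_tuple_sort.aemeasurable
  refine eq_uniformPerm_of_forall_singleton_eq fun π => ?_
  have hmp := measurePreserving_comp_injective unitMeasure π⁻¹.injective
  rw [Measure.map_apply measurable_tuple_sort (measurableSet_singleton _),
    Measure.map_apply measurable_tuple_sort (measurableSet_singleton _),
    ← hmp.measure_preimage (measurable_tuple_sort (measurableSet_singleton _)).nullMeasurableSet]
  refine measure_congr ?_
  filter_upwards [ae_injective_pi_unitMeasure] with y hy
  have h1 : (y ∘ ⇑π⁻¹) ∘ Tuple.sort (y ∘ ⇑π⁻¹) = y ∘ Tuple.sort y :=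
    Tuple.comp_perm_comp_sort_eq_comp_sort
  have h2 : π⁻¹ * Tuple.sort (y ∘ ⇑π⁻¹) = Tuple.sort y := by
    ext i
    have := congrFun h1 i
    exact congrArg Fin.val (hy this)
  refine propext ?_
  change Tuple.sort (y ∘ ⇑π⁻¹) = π ↔ Tuple.sort y = 1
  rw [← h2, inv_mul_eq_one, eq_comm]

/-- The permutation that lists the ranks of the second coordinates of the points `p`, taken by
increasing first coordinate. -/
noncomputable def inducedPerm (p : Fin n → ℝ × ℝ) : Equiv.Perm (Fin n) :=
  (Tuple.sort fun i => (p i).2)⁻¹ * Tuple.sort fun i => (p i).1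

/-- The permutation induced by independent uniform points is uniform. -/
theorem measurePreserving_inducedPerm (n : ℕ) :
    MeasurePreserving inducedPerm (Measure.pi fun _ : Fin n => squareMeasure) (uniformPerm n) := by
  have h1 := measurePreserving_arrowProdEquivProdArrow ℝ ℝ (Fin n) (fun _ => unitMeasure)
    (fun _ => unitMeasure)
  have hs : MeasurePreserving (Tuple.sort : (Fin n → ℝ) → _)
    (Measure.pi fun _ => unitMeasure) (uniformPerm n) := ⟨measurable_tuple_sort, map_tuple_sort_pi⟩
  have h2 := hs.prod hs
  have h3 : MeasurePreserving (fun z : Equiv.Perm (Fin n) × Equiv.Perm (Fin n) => z.2⁻¹ * z.1)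
      ((uniformPerm n).prod (uniformPerm n)) (uniformPerm n) := by
    have hm : Measurable fun z : Equiv.Perm (Fin n) × Equiv.Perm (Fin n) => z.2⁻¹ * z.1 :=
      measurable_of_countable _
    refine ⟨hm, Measure.ext_of_singleton fun π => ?_⟩
    rw [Measure.map_apply hm (measurableSet_singleton _),
      Measure.prod_apply (hm (measurableSet_singleton _))]
    have : ∀ α : Equiv.Perm (Fin n), uniformPerm n (Prod.mk α ⁻¹'
        ((fun z : Equiv.Perm (Fin n) × Equiv.Perm (Fin n) => z.2⁻¹ * z.1) ⁻¹' {π})) =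
        (n ! : ENNReal)⁻¹ := by
      intro α
      rw [← uniformPerm_singleton (α * π⁻¹)]
      congr 1
      ext β
      simp only [Set.mem_preimage, Set.mem_singleton_iff]
      rw [inv_mul_eq_iff_eq_mul, eq_mul_inv_iff_mul_eq, eq_comm]
    simp only [this, uniformPerm_singleton]
    simp
  exact h3.comp (h2.comp h1)

theorem isReduction_iff_strictMono {α : Type*} [LinearOrder α] {k : ℕ} (a : Fin k → α)
    (τ : Equiv.Perm (Fin k)) : IsReduction a τ ↔ StrictMono fun i => a (τ.symm i) := by
  constructor
  · intro h i j hij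
    rw [← h]
    simpa using hij
  · intro h i j
    simpa using (h.lt_iff_lt (a := τ i) (b := τ j)).symm

theorem strictMono_comp_tuple_sort {y : Fin n → ℝ} (hy : Function.Injective y) :
    StrictMono (y ∘ Tuple.sort y) :=
  (Tuple.monotone_sort y).strictMono_of_injective (hy.comp (Tuple.sort y).injective)

theorem countVar_inducedPerm (σ : Pattern) {p : Fin n → ℝ × ℝ}
    (hx : Function.Injective fun i => (p i).1) (hy : Function.Injective fun i => (p i).2) :
    countVar σ n (inducedPerm p) = vStat (patternInd σ) p := by
  classical
  set x : Fin n → ℝ := fun i => (p i).1 with hxdef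
  set y : Fin n → ℝ := fun i => (p i).2 with hydef
  have hxs := strictMono_comp_tuple_sort hx
  have hys := strictMono_comp_tuple_sort hy
  have hπ : ∀ u v, inducedPerm p u < inducedPerm p v ↔
      y (Tuple.sort x u) < y (Tuple.sort x v) := by
    intro u v
    rw [← hys.lt_iff_lt]
    simp [inducedPerm, ← hxdef, ← hydef]
  have hred : ∀ s : Fin σ.len → Fin n, IsReduction (fun i => inducedPerm p (s i)) σ.perm ↔
      StrictMono fun i => y (Tuple.sort x (s (σ.perm.symm i))) := by
    intro s
    rw [isReduction_iff_strictMono]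
    exact ⟨fun h i j hij => (hπ _ _).1 (h hij), fun h i j hij => (hπ _ _).2 (h hij)⟩
  have hmono : ∀ s : Fin σ.len → Fin n, StrictMono s ↔ StrictMono fun i => x (Tuple.sort x (s i)) :=
    fun s => ⟨fun h i j hij => hxs (h hij), fun h i j hij => hxs.lt_iff_lt.1 (h hij)⟩
  have hcard : patternCount σ (inducedPerm p) = Nat.card {s : Fin σ.len → Fin n //
      StrictMono (fun a => x (s a)) ∧ StrictMono fun a => y (s (σ.perm.symm a))} := by
    refine Nat.card_congr
      { toFun := fun s => ⟨fun a => Tuple.sort x (s.1 a), (hmono _).1 s.1.strictMono,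
          (hred _).1 s.2⟩
        invFun := fun s => ⟨OrderEmbedding.ofStrictMono (fun a => (Tuple.sort x)⁻¹ (s.1 a))
          ((hmono _).2 (by simpa using s.2.1)), (hred _).2 (by simpa using s.2.2)⟩
        left_inv := fun s => by
          apply Subtype.ext
          ext a
          simp
        right_inv := fun s => by
          apply Subtype.ext
          funext a
          simp }
  rw [countVar, hcard, Nat.card_eq_fintype_card, Fintype.card_subtype, vStat,
    Finset.card_eq_sum_ones, Finset.sum_filter]
  push_cast
  refine Finset.sum_congr rfl fun s _ => ?_
  simp only [patternInd, strictMonoInd]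
  by_cases h1 : StrictMono fun a => (p (s a)).1 <;>
    by_cases h2 : StrictMono fun a => (p (s (σ.perm.symm a))).2 <;> simp [h1, h2, hxdef, hydef]

theorem ae_countVar_inducedPerm (n : ℕ) :
    ∀ᵐ p ∂(Measure.pi fun _ : Fin n => squareMeasure), ∀ σ : Pattern,
      countVar σ n (inducedPerm p) = vStat (patternInd σ) p := by
  have h1 := measurePreserving_arrowProdEquivProdArrow ℝ ℝ (Fin n) (fun _ => unitMeasure)
    (fun _ => unitMeasure)
  have hx := h1.quasiMeasurePreserving.ae (Measure.quasiMeasurePreserving_fst.ae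
    ae_injective_pi_unitMeasure)
  have hy := h1.quasiMeasurePreserving.ae (Measure.quasiMeasurePreserving_snd.ae
    ae_injective_pi_unitMeasure)
  filter_upwards [hx, hy] with p hxp hyp σ
  exact countVar_inducedPerm σ hxp hyp

/-- Expectations over uniform permutations of functions of the pattern counts are expectations of
the same functions of V-statistics of uniform points. -/
theorem integral_uniformPerm_comp {ι E : Type*} [NormedAddCommGroup E] [NormedSpace ℝ E]
    (σ : ι → Pattern) (F : (ι → ℝ) → E) (n : ℕ) :
    ∫ π, F (fun i => countVar (σ i) n π) ∂(uniformPerm n) =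
      ∫ p : Fin n → ℝ × ℝ, F (fun i => vStat (patternInd (σ i)) p)
        ∂(Measure.pi fun _ => squareMeasure) := by
  rw [← integral_comp_measurePreserving (measurePreserving_inducedPerm n)
    (g := fun π => F (fun i => countVar (σ i) n π))
    (StronglyMeasurable.of_discrete).aestronglyMeasurable]
  refine integral_congr_ae ?_
  filter_upwards [ae_countVar_inducedPerm n] with p hp
  simp only [hp]

theorem integral_vStat_patternInd (σ : Pattern) (n : ℕ) :
    ∫ p : Fin n → ℝ × ℝ, vStat (patternInd σ) p ∂(Measure.pi fun _ => squareMeasure) =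
      (n.choose σ.len : ℝ) / (σ.len ! : ℝ) := by
  classical
  have hm := measurable_patternInd σ
  unfold vStat
  have hi : ∀ s : Fin σ.len → Fin n, Integrable (fun p : Fin n → ℝ × ℝ =>
      patternInd σ fun a => p (s a)) (Measure.pi fun _ => squareMeasure) := fun s =>
    integrable_of_measurable_of_abs_le (hm.comp (by fun_prop)) fun p => abs_patternInd_le σ _
  rw [integral_finsetSum _ fun s _ => hi s]
  have h1 : ∀ s : Fin σ.len → Fin n, ∫ p : Fin n → ℝ × ℝ, patternInd σ (fun a => p (s a))
      ∂(Measure.pi fun _ => squareMeasure) =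
      if Function.Injective s then 1 / (σ.len ! : ℝ) ^ 2 else 0 := by
    intro s
    split_ifs with hs
    · rw [← kernelMean_patternInd]
      exact integral_comp_measurePreserving (measurePreserving_comp_injective squareMeasure hs)
        hm.aestronglyMeasurable
    · have : ∀ p : Fin n → ℝ × ℝ, patternInd σ (fun a => p (s a)) = 0 := by
        intro p
        have : ¬ StrictMono fun a => (p (s a)).1 := fun h =>
          hs fun a b hab => h.injective (by simp only [hab])
        simp [patternInd, strictMonoInd, this]
      simp [this]
  rw [Finset.sum_congr rfl fun s _ => h1 s, ← Finset.sum_filter, Finset.sum_const,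
    ← Fintype.card_subtype, Fintype.card_congr (Equiv.subtypeInjectiveEquivEmbedding _ _),
    Fintype.card_embedding_eq, Fintype.card_fin, Fintype.card_fin,
    Nat.descFactorial_eq_factorial_mul_choose, nsmul_eq_mul]
  have : (σ.len ! : ℝ) ≠ 0 := by exact_mod_cast σ.len.factorial_ne_zero
  push_cast
  field_simp

end Coupling

/-! ### Convergence in distribution and convergence of expectations -/

section UniformIntegrability

/-- Truncation at level `K` changes the mean by at most the second moment divided by `K`. -/
theorem abs_integral_sub_integral_truncation_le {α : Type*} [MeasurableSpace α] {m : Measure α}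
    [IsProbabilityMeasure m] {V : α → ℝ} (hVm : AEMeasurable V m)
    (hV2 : Integrable (fun ω => V ω ^ 2) m) {K : ℝ} (hK : 0 < K) :
    |∫ ω, V ω ∂m - ∫ ω, max (-K) (min (V ω) K) ∂m| ≤ (∫ ω, V ω ^ 2 ∂m) / K := by
  have hV1 : Integrable V m := by
    refine Integrable.mono' (hV2.add (integrable_const 1)) hVm.aestronglyMeasurable
      (Eventually.of_forall fun ω => ?_)
    rw [Real.norm_eq_abs, Pi.add_apply, ← sq_abs]
    nlinarith [sq_nonneg (|V ω| - 1), abs_nonneg (V ω)]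
  have hT : Integrable (fun ω => max (-K) (min (V ω) K)) m := by
    refine Integrable.of_bound (by fun_prop) K (Eventually.of_forall fun ω => ?_)
    rw [Real.norm_eq_abs, abs_le]
    exact ⟨le_max_left _ _, max_le (by linarith) (min_le_right _ _)⟩
  rw [← integral_sub hV1 hT, ← integral_div]
  refine (abs_integral_le_integral_abs).trans (integral_mono (hV1.sub hT).abs
    (hV2.div_const K) fun ω => ?_)
  simp only
  rw [le_div_iff₀ hK]
  rcases le_total (V ω) K with h1 | h1
  · rw [min_eq_left h1]
    rcases le_total (-K) (V ω) with h2 | h2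
    · rw [max_eq_right h2, sub_self, abs_zero, zero_mul]; positivity
    · rw [max_eq_left h2, abs_of_nonpos (by linarith)]
      nlinarith
  · rw [min_eq_right h1, max_eq_right (by linarith), abs_of_nonneg (by linarith)]
    nlinarith

/-- Convergence in distribution and bounded second moments imply convergence of the means. -/
theorem tendsto_integral_of_tendstoInDistribution {Ω : ℕ → Type*} [∀ n, MeasurableSpace (Ω n)]
    {μ : ∀ n, Measure (Ω n)} [∀ n, IsProbabilityMeasure (μ n)] {Ω' : Type*} [MeasurableSpace Ω']
    {P : Measure Ω'} [IsProbabilityMeasure P] {Y : ∀ n, Ω n → ℝ} {W : Ω' → ℝ}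
    (h : TendstoInDistribution Y atTop W μ P) (hY : ∀ n, Integrable (fun ω => Y n ω ^ 2) (μ n))
    (hW : Integrable (fun ω => W ω ^ 2) P) {C : ℝ}
    (hC : ∀ᶠ n in atTop, ∫ ω, Y n ω ^ 2 ∂(μ n) ≤ C) :
    Tendsto (fun n => ∫ ω, Y n ω ∂(μ n)) atTop (𝓝 (∫ ω, W ω ∂P)) := by
  have htend : ∀ K : ℝ, 0 < K → Tendsto (fun n => ∫ ω, max (-K) (min (Y n ω) K) ∂(μ n)) atTop
      (𝓝 (∫ ω, max (-K) (min (W ω) K) ∂P)) := by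
    intro K hK
    have hcont : Continuous fun x : ℝ => max (-K) (min x K) := by fun_prop
    let clamp : BoundedContinuousFunction ℝ ℝ := BoundedContinuousFunction.ofNormedAddCommGroup
      (fun x => max (-K) (min x K)) hcont K fun x => by
        rw [Real.norm_eq_abs, abs_le]
        exact ⟨le_max_left _ _, max_le (by linarith) (min_le_right _ _)⟩
    have h1 := ProbabilityMeasure.tendsto_iff_forall_integral_tendsto.1 h.tendsto clamp
    simp only [ProbabilityMeasure.coe_mk] at h1
    rw [integral_map h.aemeasurable_limit clamp.continuous.aestronglyMeasurable] at h1
    refine h1.congr fun n => ?_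
    rw [integral_map (h.forall_aemeasurable n) clamp.continuous.aestronglyMeasurable]
    rfl
  rw [Metric.tendsto_atTop]
  intro ε hε
  set C' := ∫ ω, W ω ^ 2 ∂P with hC'
  set K : ℝ := 4 * (|C| + |C'| + 1) / ε with hKdef
  have hK : 0 < K := by positivity
  have hKε : ∀ D : ℝ, D ≤ |C| + |C'| → D / K < ε / 3 := by
    intro D hD
    rw [div_lt_iff₀ hK, hKdef]
    have : ε / 3 * (4 * (|C| + |C'| + 1) / ε) = 4 / 3 * (|C| + |C'| + 1) := by
      field_simp
    rw [this]
    linarith [abs_nonneg C, abs_nonneg C']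
  obtain ⟨N1, hN1⟩ := Metric.tendsto_atTop.1 (htend K hK) (ε / 3) (by positivity)
  obtain ⟨N2, hN2⟩ := eventually_atTop.1 hC
  refine ⟨max N1 N2, fun n hn => ?_⟩
  have e1 := abs_integral_sub_integral_truncation_le (h.forall_aemeasurable n) (hY n) hK
  have e2 := abs_integral_sub_integral_truncation_le h.aemeasurable_limit hW hK
  have e3 := hN1 n ((le_max_left _ _).trans hn)
  have e4 := hKε _ ((hN2 n ((le_max_right _ _).trans hn)).trans
    ((le_abs_self C).trans (le_add_of_nonneg_right (abs_nonneg C'))))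
  have e5 := hKε C' ((le_abs_self C').trans (le_add_of_nonneg_left (abs_nonneg C)))
  rw [Real.dist_eq, abs_lt] at e3 ⊢
  rw [abs_le] at e1 e2
  constructor <;> linarith [e1.1, e1.2, e2.1, e2.2, e3.1, e3.2]

theorem charFun_map_toLp {ι α : Type*} [Fintype ι] [MeasurableSpace α] {m : Measure α}
    {V : α → ι → ℝ} (hV : AEMeasurable V m) (t : EuclideanSpace ℝ ι) :
    charFun (m.map fun ω => (WithLp.toLp 2 (V ω) : EuclideanSpace ℝ ι)) t =
      ∫ ω, Complex.exp (↑(∑ i, t i * V ω i) * Complex.I) ∂m := by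
  have hV' : AEMeasurable (fun ω => (WithLp.toLp 2 (V ω) : EuclideanSpace ℝ ι)) m := by fun_prop
  have hc : Continuous fun x : EuclideanSpace ℝ ι => Complex.exp (↑(inner ℝ x t) * Complex.I) := by
    fun_prop
  rw [charFun_apply, integral_map hV' hc.aestronglyMeasurable]
  simp [PiLp.inner_apply]

/-- The Cramér–Wold device: convergence of the characteristic functions of all linear combinations
gives joint convergence in distribution. -/
theorem tendstoInDistribution_pi_of_tendsto_integral_cexp {ι : Type*} [Fintype ι] {Ω : ℕ → Type*}
    [∀ n, MeasurableSpace (Ω n)] {μ : ∀ n, Measure (Ω n)} [∀ n, IsProbabilityMeasure (μ n)]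
    {Ω' : Type*} [MeasurableSpace Ω'] {P : Measure Ω'} [IsProbabilityMeasure P]
    {X : ∀ n, Ω n → ι → ℝ} {Z : Ω' → ι → ℝ} (hX : ∀ n, AEMeasurable (X n) (μ n))
    (hZ : AEMeasurable Z P)
    (h : ∀ c : ι → ℝ, Tendsto (fun n => ∫ ω, Complex.exp (↑(∑ i, c i * X n ω i) * Complex.I)
      ∂(μ n)) atTop (𝓝 (∫ ω, Complex.exp (↑(∑ i, c i * Z ω i) * Complex.I) ∂P))) :
    TendstoInDistribution X atTop Z μ P := by
  have hlp : Measurable (WithLp.toLp 2 : (ι → ℝ) → EuclideanSpace ℝ ι) := by fun_prop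
  have key : TendstoInDistribution (fun n ω => (WithLp.toLp 2 (X n ω) : EuclideanSpace ℝ ι)) atTop
      (fun ω => WithLp.toLp 2 (Z ω)) μ P := by
    refine ⟨fun n => hlp.comp_aemeasurable (hX n), hlp.comp_aemeasurable hZ, ?_⟩
    refine ProbabilityMeasure.tendsto_iff_tendsto_charFun.2 fun t => ?_
    simp only [ProbabilityMeasure.coe_mk]
    rw [charFun_map_toLp hZ]
    exact (h t).congr fun n => (charFun_map_toLp (hX n) t).symm
  exact key.continuous_comp (g := fun x : EuclideanSpace ℝ ι => WithLp.ofLp x) (by fun_prop)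

end UniformIntegrability

/-! ### Normalized pattern counts -/

section NormalizedCounts

/-- The normalized count of the pattern `σ` among the points `p`. -/
noncomputable def normalizedVStat (σ : Pattern) {n : ℕ} (p : Fin n → ℝ × ℝ) : ℝ :=
  (vStat (patternInd σ) p - (n.choose σ.len : ℝ) / (σ.len ! : ℝ)) / (n : ℝ) ^ ((σ.len : ℝ) - 1 / 2)

theorem measurable_normalizedVStat (σ : Pattern) (n : ℕ) :
    Measurable (normalizedVStat σ : (Fin n → ℝ × ℝ) → ℝ) :=
  ((measurable_vStat (measurable_patternInd σ)).sub_const _).div_const _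

theorem integral_comp_normalizedCount {ι E : Type*} [NormedAddCommGroup E] [NormedSpace ℝ E]
    (σ : ι → Pattern) (F : (ι → ℝ) → E) (n : ℕ) :
    ∫ π, F (fun i => normalizedCount (σ i) n π) ∂(uniformPerm n) =
      ∫ p : Fin n → ℝ × ℝ, F (fun i => normalizedVStat (σ i) p)
        ∂(Measure.pi fun _ => squareMeasure) :=
  integral_uniformPerm_comp σ (fun x => F fun i =>
    (x i - (n.choose (σ i).len : ℝ) / ((σ i).len ! : ℝ)) / (n : ℝ) ^ (((σ i).len : ℝ) - 1 / 2)) n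

theorem integral_countVar (σ : Pattern) (n : ℕ) :
    ∫ π, countVar σ n π ∂(uniformPerm n) = (n.choose σ.len : ℝ) / (σ.len ! : ℝ) := by
  rw [← integral_vStat_patternInd]
  exact integral_uniformPerm_comp (fun _ : Unit => σ) (fun x => x ()) n

theorem rpow_len_sub_half (σ : Pattern) {n : ℕ} (hn : 0 < n) :
    (n : ℝ) ^ ((σ.len : ℝ) - 1 / 2) = (n : ℝ) ^ (σ.len - 1) * √n := by
  have hn' : (0 : ℝ) < n := by exact_mod_cast hn
  rw [Real.sqrt_eq_rpow, ← Real.rpow_natCast, ← Real.rpow_add hn', Nat.cast_sub σ.one_le_len]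
  congr 1
  push_cast
  ring

/-- The normalized count is a normalized sum of independent variables, up to an error that tends to
zero in mean. -/
theorem exists_integral_abs_normalizedVStat_sub_le (σ : Pattern) : ∃ C : ℝ, ∀ n : ℕ, 0 < n →
    ∫ p : Fin n → ℝ × ℝ, |normalizedVStat σ p -
      (√n)⁻¹ * ∑ j, linearPart squareMeasure (patternInd σ) (p j)|
      ∂(Measure.pi fun _ => squareMeasure) ≤ C * (√n)⁻¹ := by
  have hm := measurable_patternInd σ
  have hb := abs_patternInd_le σ
  obtain ⟨C, hC⟩ : ∃ C : ℝ, ∀ n : ℕ, ∫ p : Fin n → ℝ × ℝ,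
      vStat (degeneratePart squareMeasure (patternInd σ)) p ^ 2
      ∂(Measure.pi fun _ => squareMeasure) ≤ C * (n : ℝ) ^ (2 * (σ.len - 1)) :=
    ⟨_, integral_vStat_degeneratePart_sq_le squareMeasure hm hb⟩
  refine ⟨C + 1, fun n hn => ?_⟩
  have hn' : (0 : ℝ) < n := by exact_mod_cast hn
  set h := patternInd σ with hdef
  set D : (Fin n → ℝ × ℝ) → ℝ := fun p => vStat (degeneratePart squareMeasure h) p with hD
  have hDm : Measurable D := measurable_vStat (measurable_degeneratePart squareMeasure hm)
  have hDB : ∀ p, |D p| ≤ (n : ℝ) ^ σ.len * (2 + 2 * σ.len) := by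
    intro p
    refine (Finset.abs_sum_le_sum_abs _ _).trans ?_
    refine (Finset.sum_le_card_nsmul _ _ _ fun s _ =>
      abs_degeneratePart_le squareMeasure hb _).trans ?_
    simp [mul_add]
  have hDi : Integrable D (Measure.pi fun _ => squareMeasure) :=
    integrable_of_measurable_of_abs_le hDm hDB
  have hHi : ∀ j : Fin n, Integrable (fun p : Fin n → ℝ × ℝ => linearPart squareMeasure h (p j))
      (Measure.pi fun _ => squareMeasure) := fun j =>
    integrable_of_measurable_of_abs_le
      (f := fun p : Fin n → ℝ × ℝ => linearPart squareMeasure h (p j))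
      ((measurable_linearPart squareMeasure hm).comp (measurable_pi_apply j))
      fun p => abs_linearPart_le squareMeasure hb (p j)
  have hH0 : ∫ p : Fin n → ℝ × ℝ, ∑ j, linearPart squareMeasure h (p j)
      ∂(Measure.pi fun _ => squareMeasure) = 0 := by
    rw [integral_finsetSum _ fun j _ => hHi j]
    refine Finset.sum_eq_zero fun j _ => ?_
    rw [← integral_linearPart squareMeasure hm hb]
    exact integral_comp_measurePreserving
      (measurePreserving_eval (fun _ : Fin n => squareMeasure) j)
      (measurable_linearPart squareMeasure hm).aestronglyMeasurable
  have hmean : (n.choose σ.len : ℝ) / (σ.len ! : ℝ) =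
      (∫ p, D p ∂(Measure.pi fun _ => squareMeasure)) +
        (n : ℝ) ^ σ.len * kernelMean squareMeasure h := by
    rw [← integral_vStat_patternInd, integral_congr_ae
      (Eventually.of_forall fun p => vStat_eq_add squareMeasure h p)]
    have i1 : Integrable (fun p => D p + (n : ℝ) ^ σ.len * kernelMean squareMeasure h)
      (Measure.pi fun _ => squareMeasure) := hDi.add (integrable_const _)
    rw [integral_add i1 ((integrable_finsetSum _ fun j _ => hHi j).const_mul _),
      integral_add hDi (integrable_const _), integral_const_mul ((n : ℝ) ^ (σ.len - 1)), hH0]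
    simp
  set a : ℝ := (n : ℝ) ^ (σ.len - 1) with ha
  have ha0 : 0 < a := by positivity
  have hs : 0 < √(n : ℝ) := Real.sqrt_pos.2 hn'
  set m := ∫ p, D p ∂(Measure.pi fun _ => squareMeasure) with hmdef
  have hdiff : ∀ p : Fin n → ℝ × ℝ, normalizedVStat σ p -
      (√n)⁻¹ * ∑ j, linearPart squareMeasure h (p j) = (D p - m) / (a * √n) := by
    intro p
    rw [normalizedVStat, rpow_len_sub_half σ hn, ← hdef, vStat_eq_add squareMeasure h p, hmean,
      ← ha]
    field_simp
    ring
  have habs : ∫ p, |D p| ∂(Measure.pi fun _ => squareMeasure) ≤ (C + 1) / 2 * a := by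
    have hi2 : Integrable (fun p => D p ^ 2) (Measure.pi fun _ => squareMeasure) :=
      integrable_of_measurable_of_abs_le (hDm.pow_const 2)
        (C := ((n : ℝ) ^ σ.len * (2 + 2 * σ.len)) ^ 2) fun p => by
          rw [abs_pow]; exact pow_le_pow_left₀ (abs_nonneg _) (hDB p) 2
    have hi3 : Integrable (fun p => (D p ^ 2 / a + a) / 2) (Measure.pi fun _ => squareMeasure) :=
      ((hi2.div_const a).add (integrable_const a)).div_const 2
    calc ∫ p, |D p| ∂(Measure.pi fun _ => squareMeasure)
        ≤ ∫ p, (D p ^ 2 / a + a) / 2 ∂(Measure.pi fun _ => squareMeasure) := by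
          refine integral_mono hDi.abs hi3 fun p => ?_
          simp only
          rw [← sq_abs, le_div_iff₀ (by norm_num : (0 : ℝ) < 2), div_add' _ _ _ ha0.ne',
            le_div_iff₀ ha0]
          nlinarith [sq_nonneg (|D p| - a)]
      _ = ((∫ p, D p ^ 2 ∂(Measure.pi fun _ => squareMeasure)) / a + a) / 2 := by
          rw [integral_div, integral_add (hi2.div_const a) (integrable_const a), integral_div]
          simp
      _ ≤ (C * (n : ℝ) ^ (2 * (σ.len - 1)) / a + a) / 2 := by
          gcongr
          exact hC n
      _ = (C + 1) / 2 * a := by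
          rw [mul_comm 2, pow_mul, ← ha]
          field_simp
  simp only [hdiff]
  have hm' : |m| ≤ (C + 1) / 2 * a := abs_integral_le_integral_abs.trans habs
  calc ∫ p, |(D p - m) / (a * √n)| ∂(Measure.pi fun _ => squareMeasure)
      ≤ ∫ p, (|D p| + |m|) / (a * √n) ∂(Measure.pi fun _ => squareMeasure) := by
        refine integral_mono ((hDi.sub (integrable_const m)).div_const _).abs
          ((hDi.abs.add (integrable_const _)).div_const _) fun p => ?_
        simp only
        rw [abs_div, abs_of_pos (mul_pos ha0 hs)]
        gcongr
        exact abs_sub _ _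
    _ = ((∫ p, |D p| ∂(Measure.pi fun _ => squareMeasure)) + |m|) / (a * √n) := by
        rw [integral_div, integral_add hDi.abs (integrable_const _)]
        simp
    _ ≤ ((C + 1) / 2 * a + (C + 1) / 2 * a) / (a * √n) := by gcongr
    _ = (C + 1) * (√n)⁻¹ := by
        field_simp
        ring

theorem abs_normalizedVStat_le (σ : Pattern) (n : ℕ) : ∃ B, ∀ p : Fin n → ℝ × ℝ,
    |normalizedVStat σ p| ≤ B := by
  refine ⟨((n : ℝ) ^ σ.len + |(n.choose σ.len : ℝ) / (σ.len ! : ℝ)|) /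
    |(n : ℝ) ^ ((σ.len : ℝ) - 1 / 2)|, fun p => ?_⟩
  rw [normalizedVStat, abs_div]
  gcongr
  exact (abs_sub _ _).trans (add_le_add (abs_vStat_le (abs_patternInd_le σ) p) le_rfl)

theorem norm_cexp_mul_I_sub_le (x y : ℝ) :
    ‖Complex.exp (↑x * Complex.I) - Complex.exp (↑y * Complex.I)‖ ≤ |x - y| := by
  have h : Complex.exp (↑x * Complex.I) - Complex.exp (↑y * Complex.I) =
      Complex.exp (↑y * Complex.I) * (Complex.exp (Complex.I * ↑(x - y)) - 1) := by
    rw [mul_sub, ← Complex.exp_add]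
    push_cast
    ring_nf
  rw [h, norm_mul, Complex.norm_exp_ofReal_mul_I, one_mul]
  exact Real.norm_exp_I_mul_ofReal_sub_one_le

theorem tendsto_inv_sqrt_natCast : Tendsto (fun n : ℕ => (√(n : ℝ))⁻¹) atTop (𝓝 0) :=
  tendsto_inv_atTop_zero.comp (Real.tendsto_sqrt_atTop.comp tendsto_natCast_atTop_atTop)

/-- The characteristic functions of linear combinations of normalized counts converge. -/
theorem tendsto_integral_cexp_normalizedCount {ι : Type*} [Fintype ι] (σ : ι → Pattern)
    (c : ι → ℝ) :
    Tendsto (fun n => ∫ π, Complex.exp (↑(∑ i, c i * normalizedCount (σ i) n π) * Complex.I)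
      ∂(uniformPerm n)) atTop
      (𝓝 (Complex.exp (-↑(∑ i, ∑ j, c i * c j * limitCov (σ i) (σ j)) / 2))) := by
  simp only [integral_comp_normalizedCount σ
    (fun x => Complex.exp (↑(∑ i, c i * x i) * Complex.I))]
  set g : ℝ × ℝ → ℝ := fun z => ∑ i, c i * linearPart squareMeasure (patternInd (σ i)) z with hg
  have hHm : ∀ i, Measurable (linearPart squareMeasure (patternInd (σ i))) := fun i =>
    measurable_linearPart squareMeasure (measurable_patternInd (σ i))
  have hHb : ∀ i z, |linearPart squareMeasure (patternInd (σ i)) z| ≤ 2 * (σ i).len := fun i z =>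
    abs_linearPart_le squareMeasure (abs_patternInd_le (σ i)) z
  have hgm : Measurable g := Finset.measurable_fun_sum _ fun i _ => (hHm i).const_mul _
  have hgb : ∀ z, |g z| ≤ ∑ i, |c i| * (2 * (σ i).len) := by
    intro z
    refine (Finset.abs_sum_le_sum_abs _ _).trans (Finset.sum_le_sum fun i _ => ?_)
    rw [abs_mul]
    exact mul_le_mul_of_nonneg_left (hHb i z) (abs_nonneg _)
  have hg0 : ∫ z, g z ∂squareMeasure = 0 := by
    rw [hg, integral_finsetSum _ fun i _ =>
      (integrable_of_measurable_of_abs_le (hHm i) (hHb i)).const_mul (c i)]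
    refine Finset.sum_eq_zero fun i _ => ?_
    rw [integral_const_mul, integral_linearPart squareMeasure (measurable_patternInd (σ i))
      (abs_patternInd_le (σ i)), mul_zero]
  have hclt := tendsto_integral_cexp_inv_sqrt_mul_sum squareMeasure hgm hgb hg0
  rw [hg, integral_sum_linearPart_sq] at hclt
  choose C hC using fun i => exists_integral_abs_normalizedVStat_sub_le (σ i)
  refine tendsto_of_tendsto_of_dist hclt ?_
  have hlim : Tendsto (fun n : ℕ => ∑ i, |c i| * (C i * (√(n : ℝ))⁻¹)) atTop (𝓝 0) := by
    have := tendsto_finsetSum Finset.univ fun i _ =>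
      ((tendsto_inv_sqrt_natCast.const_mul (C i)).const_mul |c i|)
    simpa using this
  refine squeeze_zero' (Eventually.of_forall fun n => dist_nonneg) ?_ hlim
  filter_upwards [eventually_gt_atTop 0] with n hn
  have hcm : ∀ {V : (Fin n → ℝ × ℝ) → ℝ}, Measurable V → Integrable
      (fun p => Complex.exp (↑(V p) * Complex.I)) (Measure.pi fun _ => squareMeasure) := by
    intro V hV
    refine Integrable.of_bound (by fun_prop) 1 (Eventually.of_forall fun p => ?_)
    rw [Complex.norm_exp_ofReal_mul_I]
  have hN : ∀ i, Measurable (normalizedVStat (σ i) : (Fin n → ℝ × ℝ) → ℝ) := fun i =>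
    measurable_normalizedVStat (σ i) n
  have hL : ∀ i, Measurable fun p : Fin n → ℝ × ℝ =>
      (√n)⁻¹ * ∑ j, linearPart squareMeasure (patternInd (σ i)) (p j) := fun i =>
    (Finset.measurable_fun_sum _ fun j _ => (hHm i).comp (measurable_pi_apply j)).const_mul _
  have hdi : ∀ i, Integrable (fun p : Fin n → ℝ × ℝ => |normalizedVStat (σ i) p -
      (√n)⁻¹ * ∑ j, linearPart squareMeasure (patternInd (σ i)) (p j)|)
      (Measure.pi fun _ => squareMeasure) := by
    intro i
    obtain ⟨B, hB⟩ := abs_normalizedVStat_le (σ i) n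
    refine ((integrable_of_measurable_of_abs_le (hN i) hB).sub
      (integrable_of_measurable_of_abs_le (C := (√n)⁻¹ * (n * (2 * (σ i).len))) (hL i)
        fun p => ?_)).abs
    rw [abs_mul, abs_of_nonneg (by positivity : (0 : ℝ) ≤ (√n)⁻¹)]
    gcongr
    refine (Finset.abs_sum_le_sum_abs _ _).trans
      ((Finset.sum_le_card_nsmul _ _ _ fun j _ => hHb i (p j)).trans ?_)
    simp
  rw [dist_eq_norm, ← integral_sub (hcm (by fun_prop)) (hcm (by fun_prop))]
  calc ‖∫ p : Fin n → ℝ × ℝ, (Complex.exp (↑((√n)⁻¹ * ∑ j, g (p j)) * Complex.I) -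
        Complex.exp (↑(∑ i, c i * normalizedVStat (σ i) p) * Complex.I))
        ∂(Measure.pi fun _ => squareMeasure)‖
      ≤ ∫ p : Fin n → ℝ × ℝ, ∑ i, |c i| * |normalizedVStat (σ i) p -
        (√n)⁻¹ * ∑ j, linearPart squareMeasure (patternInd (σ i)) (p j)|
        ∂(Measure.pi fun _ => squareMeasure) := by
        refine norm_integral_le_of_norm_le (integrable_finsetSum _ fun i _ =>
          (hdi i).const_mul _) (Eventually.of_forall fun p => ?_)
        refine (norm_cexp_mul_I_sub_le _ _).trans ?_
        have : (√n)⁻¹ * ∑ j, g (p j) - ∑ i, c i * normalizedVStat (σ i) p =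
            -∑ i, c i * (normalizedVStat (σ i) p -
              (√n)⁻¹ * ∑ j, linearPart squareMeasure (patternInd (σ i)) (p j)) := by
          have hswap : (√n)⁻¹ * ∑ j, g (p j) = ∑ i, c i * ((√n)⁻¹ *
              ∑ j, linearPart squareMeasure (patternInd (σ i)) (p j)) := by
            simp only [hg]
            rw [Finset.sum_comm, Finset.mul_sum]
            refine Finset.sum_congr rfl fun i _ => ?_
            rw [← Finset.mul_sum]
            ring
          rw [hswap, ← Finset.sum_sub_distrib, ← Finset.sum_neg_distrib]
          exact Finset.sum_congr rfl fun i _ => by ring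
        rw [this, abs_neg]
        refine (Finset.abs_sum_le_sum_abs _ _).trans (le_of_eq ?_)
        exact Finset.sum_congr rfl fun i _ => abs_mul _ _
    _ = ∑ i, |c i| * ∫ p : Fin n → ℝ × ℝ, |normalizedVStat (σ i) p -
        (√n)⁻¹ * ∑ j, linearPart squareMeasure (patternInd (σ i)) (p j)|
        ∂(Measure.pi fun _ => squareMeasure) := by
        rw [integral_finsetSum _ fun i _ => (hdi i).const_mul _]
        exact Finset.sum_congr rfl fun i _ => integral_const_mul _ _
    _ ≤ ∑ i, |c i| * (C i * (√n)⁻¹) :=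
        Finset.sum_le_sum fun i _ => mul_le_mul_of_nonneg_left (hC i n hn) (abs_nonneg _)

/-- The absolute moments of the normalized counts are bounded. -/
theorem exists_integral_abs_normalizedCount_pow_le (σ : Pattern) (T : ℕ) : ∃ C : ℝ, ∀ n : ℕ,
    0 < n → ∫ π, |normalizedCount σ n π| ^ T ∂(uniformPerm n) ≤ C := by
  refine ⟨2 * T ! * Real.exp (1 / 2) * (2 * σ.len) ^ T, fun n hn => ?_⟩
  have hn' : (0 : ℝ) < n := by exact_mod_cast hn
  have h1 := integral_comp_normalizedCount (fun _ : Unit => σ) (fun x => |x ()| ^ T) n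
  simp only at h1
  rw [h1]
  have h2 := integral_abs_vStat_sub_pow_le squareMeasure (measurable_patternInd σ)
    (abs_patternInd_le σ) σ.one_le_len hn T
  rw [integral_vStat_patternInd] at h2
  have hr : (0 : ℝ) < (n : ℝ) ^ (σ.len - 1) * √n := by
    have := Real.sqrt_pos.2 hn'
    positivity
  simp only [normalizedVStat, rpow_len_sub_half σ hn, abs_div, div_pow, abs_of_pos hr]
  rw [integral_div, div_le_iff₀ (pow_pos hr T)]
  refine h2.trans (le_of_eq ?_)
  rw [mul_assoc (2 * (T ! : ℝ) * _), ← mul_pow]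
  ring

end NormalizedCounts

/-! ### The limit theorem -/

section LimitTheorem

variable {ι : Type*} [Fintype ι] {σ : ι → Pattern} {Ω : Type*} [MeasurableSpace Ω]
  {P : Measure Ω} {Z : ι → Ω → ℝ}

theorem IsLimitFamily.hasGaussianLaw_apply (hZ : IsLimitFamily σ Z P) (i : ι) :
    HasGaussianLaw (Z i) P :=
  hZ.jointlyGaussian.eval i

theorem IsLimitFamily.integral_cexp [IsProbabilityMeasure P] (hZ : IsLimitFamily σ Z P)
    (c : ι → ℝ) :
    ∫ ω, Complex.exp (↑(∑ i, c i * Z i ω) * Complex.I) ∂P =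
      Complex.exp (-↑(∑ i, ∑ j, c i * c j * limitCov (σ i) (σ j)) / 2) := by
  have hg : HasGaussianLaw (fun ω => ∑ i, c i * Z i ω) P := by
    have := hZ.jointlyGaussian.map_fun (∑ i, c i • ContinuousLinearMap.proj (R := ℝ) i)
    simpa using this
  have hmean : ∫ ω, ∑ i, c i * Z i ω ∂P = 0 := by
    rw [integral_finsetSum _ fun i _ => (hZ.hasGaussianLaw_apply i).integrable.const_mul (c i)]
    simp only [integral_const_mul, hZ.mean_eq_zero, mul_zero, Finset.sum_const_zero]
  have hvar : variance (fun ω => ∑ i, c i * Z i ω) P =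
      ∑ i, ∑ j, c i * c j * limitCov (σ i) (σ j) := by
    rw [variance_fun_sum fun i => (hZ.hasGaussianLaw_apply i).memLp_two.const_mul (c i)]
    refine Finset.sum_congr rfl fun i _ => Finset.sum_congr rfl fun j _ => ?_
    rw [covariance_const_mul_left, covariance_const_mul_right, hZ.cov_eq, mul_assoc]
  have h1 := charFun_apply_real (μ := P.map fun ω => ∑ i, c i * Z i ω) 1
  rw [hg.map_eq_gaussianReal, charFun_gaussianReal, ← hg.map_eq_gaussianReal,
    integral_map hg.aemeasurable (by fun_prop), hmean, hvar] at h1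
  simp only [Complex.ofReal_one, one_mul] at h1
  rw [← h1]
  have hnn : 0 ≤ ∑ i, ∑ j, c i * c j * limitCov (σ i) (σ j) := hvar ▸ variance_nonneg _ _
  congr 1
  have h2 : (((∑ i, ∑ j, c i * c j * limitCov (σ i) (σ j)).toNNReal : ℝ) : ℂ) =
      ↑(∑ i, ∑ j, c i * c j * limitCov (σ i) (σ j)) := by
    rw [Real.coe_toNNReal _ hnn]
  rw [h2]
  simp
  ring

theorem IsLimitFamily.tendstoInDistribution [IsProbabilityMeasure P] (hZ : IsLimitFamily σ Z P) :
    TendstoInDistribution (fun n π i => normalizedCount (σ i) n π) atTop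
      (fun ω i => Z i ω) uniformPerm P := by
  refine tendstoInDistribution_pi_of_tendsto_integral_cexp (fun n => ?_)
    hZ.jointlyGaussian.aemeasurable fun c => ?_
  · exact (measurable_of_countable _).aemeasurable
  · rw [hZ.integral_cexp]
    exact tendsto_integral_cexp_normalizedCount σ c

theorem sq_prod_pow_le_one_add_sum (x : ι → ℝ) (m : ι → ℕ) :
    (∏ i, x i ^ m i) ^ 2 ≤ 1 + ∑ i, |x i| ^ (2 * ∑ j, m j) := by
  rcases isEmpty_or_nonempty ι with hι | hι
  · simp
  -- the largest coordinate dominates the product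
  obtain ⟨i₀, hi₀⟩ := Finite.exists_max fun i => |x i|
  have h1 : |∏ i, x i ^ m i| ≤ |x i₀| ^ ∑ j, m j := by
    rw [Finset.abs_prod, ← Finset.prod_pow_eq_pow_sum]
    refine Finset.prod_le_prod (fun i _ => abs_nonneg _) fun i _ => ?_
    rw [abs_pow]
    exact pow_le_pow_left₀ (abs_nonneg _) (hi₀ i) _
  rw [← sq_abs]
  calc |∏ i, x i ^ m i| ^ 2 ≤ (|x i₀| ^ ∑ j, m j) ^ 2 := pow_le_pow_left₀ (abs_nonneg _) h1 2
    _ = |x i₀| ^ (2 * ∑ j, m j) := by rw [← pow_mul, mul_comm]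
    _ ≤ ∑ i, |x i| ^ (2 * ∑ j, m j) := Finset.single_le_sum
        (f := fun i => |x i| ^ (2 * ∑ j, m j)) (fun i _ => by positivity) (Finset.mem_univ i₀)
    _ ≤ _ := by linarith

theorem IsLimitFamily.integrable_sq_prod_pow [IsProbabilityMeasure P] (hZ : IsLimitFamily σ Z P)
    (m : ι → ℕ) : Integrable (fun ω => (∏ i, Z i ω ^ m i) ^ 2) P := by
  have hZm : ∀ i, AEMeasurable (Z i) P := fun i => (hZ.hasGaussianLaw_apply i).aemeasurable
  have hi : ∀ i, Integrable (fun ω => |Z i ω| ^ (2 * ∑ j, m j)) P := fun i =>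
    ((hZ.hasGaussianLaw_apply i).memLp (ENNReal.natCast_ne_top _)).integrable_norm_pow'
  refine Integrable.mono' ((integrable_const 1).add (integrable_finsetSum Finset.univ
    fun i _ => hi i)) ?_ (Eventually.of_forall fun ω => ?_)
  · exact ((Finset.aemeasurable_fun_prod _ fun i _ =>
      (hZm i).pow_const (m i)).pow_const 2).aestronglyMeasurable
  · rw [Real.norm_eq_abs, abs_of_nonneg (sq_nonneg _)]
    exact sq_prod_pow_le_one_add_sum (fun i => Z i ω) m

theorem IsLimitFamily.integrable_prod_pow [IsProbabilityMeasure P] (hZ : IsLimitFamily σ Z P)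
    (m : ι → ℕ) : Integrable (fun ω => ∏ i, Z i ω ^ m i) P := by
  have hZm : ∀ i, AEMeasurable (Z i) P := fun i => (hZ.hasGaussianLaw_apply i).aemeasurable
  have hm : AEMeasurable (fun ω => ∏ i, Z i ω ^ m i) P :=
    Finset.aemeasurable_fun_prod _ fun i _ => (hZm i).pow_const (m i)
  exact ((memLp_two_iff_integrable_sq hm.aestronglyMeasurable).2
    (hZ.integrable_sq_prod_pow m)).integrable one_le_two

theorem IsLimitFamily.tendsto_integral_prod_pow [IsProbabilityMeasure P]
    (hZ : IsLimitFamily σ Z P) (m : ι → ℕ) :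
    Tendsto (fun n => ∫ π, ∏ i, normalizedCount (σ i) n π ^ m i ∂(uniformPerm n)) atTop
      (𝓝 (∫ ω, ∏ i, Z i ω ^ m i ∂P)) := by
  choose C hC using fun i => exists_integral_abs_normalizedCount_pow_le (σ i) (2 * ∑ j, m j)
  refine tendsto_integral_of_tendstoInDistribution (C := 1 + ∑ i, C i)
    (hZ.tendstoInDistribution.continuous_comp (g := fun x : ι → ℝ => ∏ i, x i ^ m i)
      (by fun_prop)) (fun n => .of_finite) (hZ.integrable_sq_prod_pow m) ?_
  filter_upwards [eventually_gt_atTop 0] with n hn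
  calc ∫ π, (∏ i, normalizedCount (σ i) n π ^ m i) ^ 2 ∂(uniformPerm n)
      ≤ ∫ π, (1 + ∑ i, |normalizedCount (σ i) n π| ^ (2 * ∑ j, m j)) ∂(uniformPerm n) :=
        integral_mono .of_finite .of_finite fun π => sq_prod_pow_le_one_add_sum _ m
    _ = 1 + ∑ i, ∫ π, |normalizedCount (σ i) n π| ^ (2 * ∑ j, m j) ∂(uniformPerm n) := by
        rw [integral_add .of_finite .of_finite, integral_finsetSum _ fun i _ => .of_finite]
        simp
    _ ≤ 1 + ∑ i, C i := by
        gcongr with i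
        exact hC i n hn

end LimitTheorem

/-- Limit families exist: the coordinates of a multivariate normal vector with covariance matrix
`Σ`. -/
theorem isLimitFamily_multivariateGaussian {ι : Type*} [Fintype ι] [DecidableEq ι]
    (σ : ι → Pattern) :
    IsLimitFamily σ (fun i (x : EuclideanSpace ℝ ι) => x i)
      (multivariateGaussian 0 (Matrix.of fun i j => limitCov (σ i) (σ j))) where
  jointlyGaussian :=
    (IsGaussian.hasGaussianLaw_id (μ := multivariateGaussian 0
      (Matrix.of fun i j => limitCov (σ i) (σ j)))).map_equiv_fun
      (PiLp.continuousLinearEquiv 2 ℝ fun _ : ι => ℝ)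
  mean_eq_zero i := by
    rw [integral_comp_measurePreserving
      (measurePreserving_eval_multivariateGaussian (posSemidef_limitCov σ) (i := i))
      (g := fun x => x) aestronglyMeasurable_id, integral_id_gaussianReal]
    simp
  cov_eq i j := covariance_eval_multivariateGaussian (posSemidef_limitCov σ) i j

theorem tendsto_covariance_countVar (σ τ : Pattern) :
    Tendsto (fun n => covariance (countVar σ n) (countVar τ n) (uniformPerm n) /
      (n : ℝ) ^ (σ.len + τ.len - 1)) atTop (𝓝 (limitCov σ τ)) := by
  let ρ : Bool → Pattern := fun b => bif b then σ else τ
  have hZ := isLimitFamily_multivariateGaussian ρ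
  have h1 := hZ.tendsto_integral_prod_pow fun _ => 1
  have hlim := hZ.cov_eq true false
  rw [covariance, hZ.mean_eq_zero, hZ.mean_eq_zero] at hlim
  simp only [sub_zero] at hlim
  simp only [Fintype.prod_bool, pow_one] at h1
  rw [hlim] at h1
  refine h1.congr' ?_
  filter_upwards [eventually_gt_atTop 0] with n hn
  have hn' : (0 : ℝ) < n := by exact_mod_cast hn
  have hpow : (n : ℝ) ^ (σ.len + τ.len - 1) =
      (n : ℝ) ^ ((σ.len : ℝ) - 1 / 2) * (n : ℝ) ^ ((τ.len : ℝ) - 1 / 2) := by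
    rw [rpow_len_sub_half σ hn, rpow_len_sub_half τ hn]
    have h2 := σ.one_le_len
    have h3 := τ.one_le_len
    calc (n : ℝ) ^ (σ.len + τ.len - 1) = (n : ℝ) ^ (σ.len - 1) * (n : ℝ) ^ (τ.len - 1) * n := by
          rw [← pow_add, ← pow_succ]; congr 1; omega
      _ = (n : ℝ) ^ (σ.len - 1) * (n : ℝ) ^ (τ.len - 1) * (√n * √n) := by
          rw [Real.mul_self_sqrt hn'.le]
      _ = _ := by ring
  rw [covariance, integral_countVar, integral_countVar, hpow, ← integral_div]
  refine integral_congr_ae (Eventually.of_forall fun π => ?_)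
  simp only [ρ, normalizedCount, cond_true, cond_false]
  rw [div_mul_div_comm]

theorem theorem1 :
    -- the expectation of the pattern count
    (∀ (σ : Pattern) (n : ℕ),
      ∫ π, countVar σ n π ∂(uniformPerm n) = (n.choose σ.len : ℝ) / (σ.len ! : ℝ)) ∧
    -- the covariances of the limit variables are admissible, so that limit families exist
    (∀ {ι : Type*} [Fintype ι] (σ : ι → Pattern),
      (Matrix.of fun i j => limitCov (σ i) (σ j)).PosSemidef) ∧
    -- convergence in distribution for one pattern
    (∀ (σ : Pattern) {Ω : Type*} [MeasurableSpace Ω] (P : Measure Ω) [IsProbabilityMeasure P]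
      (Z : Ω → ℝ), HasGaussianLaw Z P → ∫ ω, Z ω ∂P = 0 → variance Z P = limitCov σ σ →
      TendstoInDistribution (fun n => normalizedCount σ n) atTop Z uniformPerm P) ∧
    -- joint convergence in distribution for a finite family of patterns
    (∀ {ι : Type*} [Fintype ι] (σ : ι → Pattern)
      {Ω : Type*} [MeasurableSpace Ω] (P : Measure Ω) [IsProbabilityMeasure P]
      (Z : ι → Ω → ℝ), IsLimitFamily σ Z P →
      TendstoInDistribution (fun n π i => normalizedCount (σ i) n π) atTop
        (fun ω i => Z i ω) uniformPerm P) ∧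
    -- convergence of all joint moments
    (∀ {ι : Type*} [Fintype ι] (σ : ι → Pattern)
      {Ω : Type*} [MeasurableSpace Ω] (P : Measure Ω) [IsProbabilityMeasure P]
      (Z : ι → Ω → ℝ), IsLimitFamily σ Z P → ∀ m : ι → ℕ,
      Integrable (fun ω => ∏ i, Z i ω ^ m i) P ∧
      Tendsto (fun n => ∫ π, ∏ i, normalizedCount (σ i) n π ^ m i ∂(uniformPerm n)) atTop
        (𝓝 (∫ ω, ∏ i, Z i ω ^ m i ∂P))) ∧
    -- convergence of the covariances
    (∀ σ τ : Pattern,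
      Tendsto (fun n => covariance (countVar σ n) (countVar τ n) (uniformPerm n) /
          (n : ℝ) ^ (σ.len + τ.len - 1)) atTop
        (𝓝 (limitCov σ τ))) := by
  refine ⟨integral_countVar, fun σ => posSemidef_limitCov σ, ?_,
    fun σ _ _ P _ Z hZ => hZ.tendstoInDistribution,
    fun σ _ _ P _ Z hZ m => ⟨hZ.integrable_prod_pow m, hZ.tendsto_integral_prod_pow m⟩,
    tendsto_covariance_countVar⟩
  intro σ Ω _ P _ Z hZ hmean hvar
  have hfam : IsLimitFamily (fun _ : Unit => σ) (fun _ => Z) P :=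
    { jointlyGaussian :=
        hZ.map_fun (ContinuousLinearMap.pi fun _ : Unit => ContinuousLinearMap.id ℝ ℝ)
      mean_eq_zero := fun _ => hmean
      cov_eq := fun _ _ => by rw [covariance_self hZ.aemeasurable, hvar] }
  exact hfam.tendstoInDistribution.continuous_comp (g := fun x : Unit → ℝ => x ()) (by fun_prop)
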